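/- **Conventions.** On $\mathbb{R}^d$ ($d\ge 1$) let $\hat f(\omega)=(2\pi)^{-d/2}\int_{\mathbb{R}^d} f(x)e^{-i\omega\cdot x}\,dx$, extended to tempered distributions, and let $(f*K)(x)=(2\pi)^{-d/2}\int_{\mathbb{R}^d} f(y)K(x-y)\,dy$, so that $(f*K)^{\wedge}=\hat f\,\hat K$. For $k\in\mathbb{R}$ and $1\le p\le\infty$ the Bessel-potential space $L^{k,p}$ consists of the $f$ with $\hat f=(1+\|\cdot\|_2^2)^{-k/2}\hat u$ for some $u\in L^p(\mathbb{R}^d)$, with norm $\|f\|_{L^{k,p}}=\|u\|_p$. **Admissible functions.** A radial function $\Phi:\mathbb{R}^d\to\mathbb{R}$ with generalized Fourier transform $\hat\Phi(\omega)=\phi(\|\omega\|_2)$ (that is, $\Phi$ defines a tempered distribution whose Fourier transform agrees on $\mathbb{R}^d\setminus\{0\}$ with this locally integrable function) is *admissible of order $\beta$* if $\beta>d$ and there are constants $C_1,C_2>0$ such that for all $\sigma\ge 1$, $x\ge \tfrac12$ and all integers $0\le l\le\lceil (d+3)/2\rceil$ $$C_1\le \phi(\sigma x)\,(1+(\sigma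 x)^2)^{\beta/2}\le C_2,\qquad \left|\frac{d^l}{dx^l}\Big[(1+(\sigma x)^2)^{\beta/2}\phi(\sigma x)\Big]\right|\le C_2 .$$ **Kernels.** $\mathcal{K}_2$ is the set of Schwartz functions $K:\mathbb{R}^d\to\mathbb{R}$ with $\hat K(\omega)=\kappa(\|\omega\|_2)$ for a non-increasing $\kappa:[0,\infty)\to[0,\infty)$ with $\kappa=1$ on $[0,\tfrac12]$ and $\kappa=0$ on $[1,\infty)$. For $\sigma\ge1$ let $\hat K_\sigma(\omega)=\hat K(\omega/\sigma)$. **Approximation space.** For countable $X\subset\mathbb{R}^d$ let $q_X=\tfrac12\inf\{\|\xi-\xi'\|_2:\xi,\xi'\in X,\ \xi\ne\xi'\}$, and let $S_X(\Phi)$ be the set of those finite linear combinations of translates $\Phi(\cdot-\xi)$, $\xi\in X$, that lie in $L^1(\mathbb{R}^d)$. **Theorem.** Let $\Phi$ be admissible of order $\beta$, let $K\in\mathcal{K}_2$, and let $k\in\mathbb{R}$ with $k<\beta-d$. Then there is a constant $C>0$, depending only on $\Phi$ (hence $\beta$), $d$, $K$ and $k$, such that the following holds. For every countable $X\subset\mathbb{R}^d$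 with $0<q_X<1$, every finite family of distinct points $\xi_1,\dots,\xi_N\in X$ and all $a\in\mathbb{R}^N$ for which $g=\sum_{j=1}^N a_j\Phi(\cdot-\xi_j)\in S_X(\Phi)$, and every $1\le p\le\infty$ with conjugate exponent $p'$, the function $g-g*K_{\sigma_1}$ with $\sigma_1=1/q_X$ belongs to $L^{k,p}$ and $$\|g-g*K_{\sigma_1}\|_{L^{k,p}}\le C\,q_X^{\,\beta-k-d/p'}\,\|a\|_p,$$ where $\|a\|_p$ is the $\ell^p$ norm of $a$. -/

import Mathlib

open MeasureTheory
open scoped ENNReal NNReal SchwartzMap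

noncomputable section

/-- The Fourier transform `f̂(ω) = (2π)^(-d/2) ∫ f(x) exp(-i ω·x) dx` on `ℝ^d`. -/
def fourierHat {d : ℕ} (f : EuclideanSpace ℝ (Fin d) → ℂ) (ω : EuclideanSpace ℝ (Fin d)) : ℂ :=
  (((2 * Real.pi) ^ (-(d : ℝ) / 2) : ℝ) : ℂ) *
    ∫ x, f x * Complex.exp (-((inner ℝ ω x : ℝ) : ℂ) * Complex.I)

/-- `f` is a (locally integrable) function defining a tempered distribution by integration:
it is integrable against some negative power of `1 + ‖x‖`. -/
def IsTemperedFun {d : ℕ} (f : EuclideanSpace ℝ (Fin d) → ℂ) : Prop :=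
  ∃ N : ℕ, Integrable (fun x => (((1 + ‖x‖) ^ (-(N : ℝ)) : ℝ) : ℂ) * f x)

/-- `f̂ = (1 + ‖·‖²)^(-k/2) û` in the sense of tempered distributions, i.e. tested against
Schwartz functions `ψ` with the Fourier transforms moved to the test functions. -/
def IsBesselPotentialOf {d : ℕ} (k : ℝ) (f u : EuclideanSpace ℝ (Fin d) → ℂ) : Prop :=
  ∀ ψ : 𝓢(EuclideanSpace ℝ (Fin d), ℂ),
    ∫ x, f x * fourierHat (fun ω => ψ ω) x =
      ∫ x, u x * fourierHat (fun ω => (((1 + ‖ω‖ ^ 2) ^ (-k / 2) : ℝ) : ℂ) * ψ ω) x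

/-- The function `f` belongs to the Bessel-potential space `L^{k,p}(ℝ^d)`. -/
def MemBesselSpace {d : ℕ} (k : ℝ) (p : ℝ≥0∞) (f : EuclideanSpace ℝ (Fin d) → ℂ) : Prop :=
  IsTemperedFun f ∧ ∃ u, MemLp u p ∧ IsBesselPotentialOf k f u

/-- The norm `‖f‖_{L^{k,p}} = ‖u‖_p`, where `f̂ = (1 + ‖·‖²)^(-k/2) û` and `u ∈ L^p`. Such a `u` is
unique up to null sets, so the infimum only picks its norm (and is `∞` if there is none). -/
def besselNorm {d : ℕ} (k : ℝ) (p : ℝ≥0∞) (f : EuclideanSpace ℝ (Fin d) → ℂ) : ℝ≥0∞ :=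
  ⨅ (u : EuclideanSpace ℝ (Fin d) → ℂ) (_ : MemLp u p) (_ : IsBesselPotentialOf k f u),
    eLpNorm u p

/-- `Φ` has the radial generalized Fourier transform `ω ↦ φ(‖ω‖)`: `Φ` defines a tempered
distribution whose Fourier transform is, on `ℝ^d ∖ {0}`, the locally integrable function `φ(‖·‖)`.
Only the values of `φ` on `(0, ∞)` matter. -/
def HasRadialGenFourier {d : ℕ} (Φ : EuclideanSpace ℝ (Fin d) → ℝ) (φ : ℝ → ℝ) : Prop :=
  IsTemperedFun (fun x => (Φ x : ℂ)) ∧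
  LocallyIntegrableOn (fun ω : EuclideanSpace ℝ (Fin d) => φ ‖ω‖) {0}ᶜ ∧
  ∀ γ : 𝓢(EuclideanSpace ℝ (Fin d), ℂ), HasCompactSupport γ → 0 ∉ tsupport γ →
    ∫ x, (Φ x : ℂ) * fourierHat (fun ω => γ ω) x = ∫ ω, (φ ‖ω‖ : ℂ) * γ ω

/-- `Φ` is an admissible radial function of order `β`. The derivatives in the last clause are
those, with respect to `x ∈ [1/2, ∞)`, of `x ↦ (1 + (σ x)²)^(β/2) φ(σ x)`; they are required to
exist up to order `⌈(d + 3) / 2⌉` and to be bounded uniformly in `σ ≥ 1`. -/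
def IsAdmissible {d : ℕ} (Φ : EuclideanSpace ℝ (Fin d) → ℝ) (β : ℝ) : Prop :=
  (∀ x y, ‖x‖ = ‖y‖ → Φ x = Φ y) ∧ (d : ℝ) < β ∧
  ∃ φ : ℝ → ℝ, HasRadialGenFourier Φ φ ∧
    ∃ C₁ C₂ : ℝ, 0 < C₁ ∧ 0 < C₂ ∧ ∀ σ : ℝ, 1 ≤ σ →
      (∀ x : ℝ, 1 / 2 ≤ x →
        C₁ ≤ φ (σ * x) * (1 + (σ * x) ^ 2) ^ (β / 2) ∧
        φ (σ * x) * (1 + (σ * x) ^ 2) ^ (β / 2) ≤ C₂) ∧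
      (∀ l : ℕ, l < ⌈((d : ℝ) + 3) / 2⌉₊ →
        DifferentiableOn ℝ
          (iteratedDerivWithin l (fun x => (1 + (σ * x) ^ 2) ^ (β / 2) * φ (σ * x))
            (Set.Ici (1 / 2)))
          (Set.Ici (1 / 2))) ∧
      (∀ l : ℕ, l ≤ ⌈((d : ℝ) + 3) / 2⌉₊ → ∀ x : ℝ, 1 / 2 ≤ x →
        |iteratedDerivWithin l (fun x => (1 + (σ * x) ^ 2) ^ (β / 2) * φ (σ * x))
            (Set.Ici (1 / 2)) x| ≤ C₂)

/-- The class `𝒦₂` of kernels: real Schwartz functions whose Fourier transform is `κ(‖·‖)` for a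
non-increasing `κ : [0, ∞) → [0, ∞)` equal to `1` on `[0, 1/2]` and to `0` on `[1, ∞)`. -/
def IsBandKernel {d : ℕ} (K : 𝓢(EuclideanSpace ℝ (Fin d), ℝ)) : Prop :=
  ∃ κ : ℝ≥0 → ℝ≥0, Antitone κ ∧
    (∀ ω, fourierHat (fun x => (K x : ℂ)) ω = ((κ ‖ω‖₊ : ℝ) : ℂ)) ∧
    (∀ r, r ≤ 1 / 2 → κ r = 1) ∧ (∀ r, 1 ≤ r → κ r = 0)

/-- The rescaled kernel `K_σ(x) = σ^d K(σ x)`; it is the function whose Fourier transform is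
`K̂(·/σ)`, see `fourierHat_dilate`. -/
def dilate {d : ℕ} (σ : ℝ) (K : EuclideanSpace ℝ (Fin d) → ℝ) (x : EuclideanSpace ℝ (Fin d)) : ℝ :=
  σ ^ d * K (σ • x)

theorem fourierHat_dilate {d : ℕ} {σ : ℝ} (hσ : 0 < σ) (K : EuclideanSpace ℝ (Fin d) → ℝ)
    (ω : EuclideanSpace ℝ (Fin d)) :
    fourierHat (fun x => (dilate σ K x : ℂ)) ω = fourierHat (fun x => (K x : ℂ)) (σ⁻¹ • ω) := by
  have h := Measure.integral_comp_smul (volume : Measure (EuclideanSpace ℝ (Fin d)))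
    (fun x => (K x : ℂ) * Complex.exp (-((inner ℝ (σ⁻¹ • ω) x : ℝ) : ℂ) * Complex.I)) σ
  have h1 : ∀ x : EuclideanSpace ℝ (Fin d), inner ℝ (σ⁻¹ • ω) (σ • x) = inner ℝ ω x := by
    intro x
    rw [real_inner_smul_left, real_inner_smul_right, ← mul_assoc, inv_mul_cancel₀ hσ.ne', one_mul]
  simp only [h1] at h
  have h2 : (σ ^ d : ℝ) * |(σ ^ d)⁻¹| = 1 := by
    rw [abs_of_pos (by positivity), mul_inv_cancel₀ (by positivity)]
  unfold fourierHat dilate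
  congr 1
  simp only [Complex.ofReal_mul, mul_assoc]
  rw [integral_const_mul]
  rw [h, finrank_euclideanSpace_fin, Complex.real_smul, ← mul_assoc, ← Complex.ofReal_mul, h2]
  simp

/-- Convolution `(f * K)(x) = (2π)^(-d/2) ∫ f(y) K(x - y) dy`, in the normalization that goes with
`fourierHat`: the Fourier transform of `f * K` is `f̂ K̂`. -/
def convHat {d : ℕ} (f K : EuclideanSpace ℝ (Fin d) → ℝ) (x : EuclideanSpace ℝ (Fin d)) : ℝ :=
  (2 * Real.pi) ^ (-(d : ℝ) / 2) * ∫ y, f y * K (x - y)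

/-- The separation radius `q_X`, half the infimum of the distances of distinct points of `X`
(with value `0` if `X` has at most one point). -/
def separationRadius {d : ℕ} (X : Set (EuclideanSpace ℝ (Fin d))) : ℝ :=
  X.infsep / 2

/-- The network `∑ⱼ aⱼ Φ(· - ξⱼ)`. -/
def rbfNetwork {d N : ℕ} (Φ : EuclideanSpace ℝ (Fin d) → ℝ) (ξ : Fin N → EuclideanSpace ℝ (Fin d))
    (a : Fin N → ℝ) (x : EuclideanSpace ℝ (Fin d)) : ℝ :=
  ∑ j, a j * Φ (x - ξ j)

/-- The approximation space `S_X(Φ)`: finite linear combinations of translates of `Φ` by distinct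
points of `X` that are integrable on `ℝ^d`. -/
def rbfSpace {d : ℕ} (Φ : EuclideanSpace ℝ (Fin d) → ℝ) (X : Set (EuclideanSpace ℝ (Fin d))) :
    Set (EuclideanSpace ℝ (Fin d) → ℝ) :=
  {g | (∃ (N : ℕ) (ξ : Fin N → EuclideanSpace ℝ (Fin d)) (a : Fin N → ℝ),
      Function.Injective ξ ∧ (∀ j, ξ j ∈ X) ∧ g = rbfNetwork Φ ξ a) ∧ Integrable g}

end

noncomputable section

/-! Write `σ = 1/q`. Away from the origin the transform of `g` is `φ(‖ω‖) ∑ aⱼ exp(-i ω·ξⱼ)`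
(`fourierHat_rbfNetwork_ae_eq`), and the factor `1 - K̂(ω/σ)` removes the ball `‖ω‖ ≤ σ/2`, so the
possible singularity of `φ` at `0` plays no role. Hence the Bessel potential representative of `g -
g*K_σ` is explicitly `u = ∑ aⱼ h(· - ξⱼ)`, where `h = Ĥ` and `H(ω) = (1+‖ω‖²)^((k-β)/2) F(‖ω‖) (1 -
K̂(ω/σ))` with `F(r) = (1+r²)^(β/2) φ(r)` (`isBesselPotentialOf_sub_convHat`).

Hölder's inequality in the sum (`eLpNorm_sum_mul_translate_le`) gives `‖u‖_p ≤ A^(1/p) S^(1/p')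
‖a‖_p`, where `A` bounds `‖h‖₁` and `S` bounds `∑ |h(x - ξⱼ)|` uniformly in `x`. It remains to show
`A ≲ σ^(k-β)` and `S ≲ σ^(k-β+d)`; the stated power of `q` then follows by combining exponents.

Both bounds come from `exists_fourier_radialSymbol_le`. The cut-off `1 - K̂(ω/σ)` telescopes into
dyadic differences living at the scales `s = 2ⁿσ`. Rescaled by `s`, each piece is `s^(k-β)` times a
symbol supported in a fixed annulus, with derivatives bounded uniformly in `s` by admissibility.
Bernstein's estimate (`exists_lintegral_fourier_le`) bounds the `L¹` norm of its transform, and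
band-limitedness bounds the sums of that transform over separated points (`exists_sum_fourier_le`).
Undoing the scaling yields `s^(k-β)` and `s^(k-β+d)`, and the geometric series over `n` converge
because `k - β + d < 0`. -/

theorem iteratedFDeriv_eq_zero_of_notMem {V : Type*} [NormedAddCommGroup V] [NormedSpace ℝ V]
    {f : V → ℂ} {s : Set V} (hs : IsClosed s)
    (h : ∀ x ∉ s, f x = 0) (n : ℕ) {x : V} (hx : x ∉ s) : iteratedFDeriv ℝ n f x = 0 := by
  have h1 : f =ᶠ[nhds x] fun _ => 0 := by
    filter_upwards [hs.isOpen_compl.mem_nhds hx] with y hy using h y hy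
  rw [(h1.iteratedFDeriv ℝ n).eq_of_nhds]
  simp

/-! ### Plancherel and Bernstein's `L¹` bound for Fourier transforms -/

section FourierEstimates

open FourierTransform

variable {V : Type*} [NormedAddCommGroup V] [InnerProductSpace ℝ V] [FiniteDimensional ℝ V]
  [MeasurableSpace V] [BorelSpace V]

theorem integral_fourier_mul_eq_mul_fourier {f g : V → ℂ} (hf : Integrable f)
    (hg : Integrable g) : ∫ x, 𝓕 f x * g x = ∫ x, f x * 𝓕 g x := by
  have h := VectorFourier.integral_fourierIntegral_smul_eq_flip (L := innerₗ V)
    Real.continuous_fourierChar continuous_inner hf hg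
  simp only [smul_eq_mul, flip_innerₗ] at h
  exact h

theorem continuous_fourier_of_integrable {f : V → ℂ} (hf : Integrable f) :
    Continuous (𝓕 f) :=
  VectorFourier.fourierIntegral_continuous (L := innerₗ V) Real.continuous_fourierChar
    continuous_inner hf

theorem integral_mul_coeFn_fourier_toLp {f : V → ℂ} (h1 : Integrable f) (h2 : MemLp f 2)
    (ψ : 𝓢(V, ℂ)) :
    ∫ x, ψ x * (𝓕 (h2.toLp f) : Lp ℂ 2 (volume : Measure V)) x = ∫ x, ψ x * 𝓕 f x := by
  have e := congrArg (fun T : 𝓢'(V, ℂ) => T ψ)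
    (Lp.fourier_toTemperedDistribution_eq (h2.toLp f))
  simp only [TemperedDistribution.fourier_apply, Lp.toTemperedDistribution_apply,
    smul_eq_mul] at e
  rw [← e]
  have e2 : ∫ x, (𝓕 ψ) x * (h2.toLp f) x = ∫ x, f x * 𝓕 (fun y => ψ y) x := by
    refine integral_congr_ae ?_
    filter_upwards [h2.coeFn_toLp] with x hx
    rw [hx, SchwartzMap.fourier_coe, mul_comm]
  rw [e2, ← integral_fourier_mul_eq_mul_fourier h1 ψ.integrable]
  simp only [mul_comm]

/-- The `L²` transform and the Fourier integral have the same pairing with every smooth compactly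
supported function, through the tempered distribution defined by `f`; two locally integrable
functions with this property agree a.e. This transfers Plancherel from `Lp` to the integral. -/
theorem coeFn_fourier_toLp_ae_eq {f : V → ℂ} (h1 : Integrable f) (h2 : MemLp f 2) :
    (𝓕 (h2.toLp f) : Lp ℂ 2 (volume : Measure V)) =ᵐ[volume] 𝓕 f := by
  set F : Lp ℂ 2 (volume : Measure V) := 𝓕 (h2.toLp f) with hF
  have hl : LocallyIntegrable F volume := (Lp.memLp F).locallyIntegrable (by norm_num)
  refine ae_eq_of_integral_contDiff_smul_eq hl
    (continuous_fourier_of_integrable h1).locallyIntegrable ?_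
  intro g hg hgs
  have hgs' : HasCompactSupport (fun x => (g x : ℂ)) := hgs.comp_left Complex.ofReal_zero
  have e := integral_mul_coeFn_fourier_toLp h1 h2
    (hgs'.toSchwartzMap (Complex.ofRealCLM.contDiff.comp hg))
  simp only [Complex.real_smul]
  exact e

/-- Plancherel's identity for the Fourier integral of an integrable, square integrable function. -/
theorem eLpNorm_fourier_eq {f : V → ℂ} (h1 : Integrable f) (h2 : MemLp f 2) :
    eLpNorm (𝓕 f) 2 = eLpNorm f 2 := by
  rw [← eLpNorm_congr_ae (coeFn_fourier_toLp_ae_eq h1 h2), ← eLpNorm_congr_ae h2.coeFn_toLp]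
  have := Lp.norm_fourier_eq (h2.toLp f)
  rw [Lp.norm_def, Lp.norm_def] at this
  exact (ENNReal.toReal_eq_toReal_iff' (Lp.eLpNorm_ne_top _) (Lp.eLpNorm_ne_top _)).1 this

theorem fourier_iteratedFDeriv_apply_const {f : V → ℂ} {M : ℕ} (hf : ContDiff ℝ M f)
    (hi : ∀ n ≤ M, Integrable (iteratedFDeriv ℝ n f)) (v x : V) :
    𝓕 (fun y => iteratedFDeriv ℝ M f y (fun _ => v)) x
      = (2 * Real.pi * Complex.I * (inner ℝ v x : ℝ)) ^ M * 𝓕 f x := by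
  have h := congrFun (Real.fourier_iteratedFDeriv (N := M) (by exact_mod_cast hf)
    (fun n hn => hi n (by exact_mod_cast hn)) le_rfl) x
  have h2 := Real.fourier_continuousMultilinearMap_apply (hi M le_rfl) (m := fun _ => v) (v := x)
  rw [← h2, h]
  rw [VectorFourier.fourierPowSMulRight_apply]
  have h3 : ((-innerSL ℝ) x) v = -inner ℝ v x := by simp [real_inner_comm]
  simp only [h3, Finset.prod_const,
    Finset.card_univ, Fintype.card_fin, Complex.real_smul, smul_eq_mul]
  rw [← mul_assoc]
  push_cast
  rw [← mul_pow]
  ring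


/-- `(1 + ‖x‖)^M` is controlled by the `M`-th powers of the coordinates. -/
theorem one_add_norm_pow_le {V : Type*} [NormedAddCommGroup V] [InnerProductSpace ℝ V] {d : ℕ}
    (b : OrthonormalBasis (Fin d) ℝ V) (M : ℕ) (x : V) :
    (1 + ‖x‖) ^ M ≤ (1 + d) ^ M * (1 + ∑ i, |inner ℝ (b i) x| ^ M) := by
  have h0 : ‖x‖ ≤ ∑ i, |inner ℝ (b i) x| := by
    conv_lhs => rw [← b.sum_repr x]
    refine (norm_sum_le _ _).trans (le_of_eq ?_)
    refine Finset.sum_congr rfl fun i _ => ?_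
    simp [norm_smul, b.repr_apply_apply]
  -- Here `m` is the maximum of `1` and the absolute values of the coordinates.
  obtain ⟨m, hm1, hm2, hm3⟩ : ∃ m : ℝ, 1 ≤ m ∧ (∀ i, |inner ℝ (b i) x| ≤ m) ∧
      m ^ M ≤ 1 + ∑ i, |inner ℝ (b i) x| ^ M := by
    have hs : ∀ i, |inner ℝ (b i) x| ^ M ≤ ∑ i, |inner ℝ (b i) x| ^ M := fun i =>
      Finset.single_le_sum (f := fun i => |inner ℝ (b i) x| ^ M) (fun j _ => by positivity)
        (Finset.mem_univ i)
    have hs0 : 0 ≤ ∑ i, |inner ℝ (b i) x| ^ M := Finset.sum_nonneg fun i _ => by positivity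
    by_cases h : ∀ i, |inner ℝ (b i) x| ≤ 1
    · exact ⟨1, le_rfl, h, by simpa using hs0⟩
    · push Not at h
      obtain ⟨i₀, hi₀⟩ := h
      obtain ⟨i, -, hi⟩ := Finset.exists_max_image Finset.univ (fun i => |inner ℝ (b i) x|)
        ⟨i₀, Finset.mem_univ _⟩
      exact ⟨|inner ℝ (b i) x|, hi₀.le.trans (hi i₀ (Finset.mem_univ _)),
        fun j => hi j (Finset.mem_univ _), by linarith [hs i]⟩
  have h1 : 1 + ‖x‖ ≤ (1 + d) * m := by
    have : ∑ i, |inner ℝ (b i) x| ≤ d * m := by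
      simpa using Finset.sum_le_card_nsmul Finset.univ (fun i => |inner ℝ (b i) x|) m
        (fun i _ => hm2 i)
    linarith
  calc (1 + ‖x‖) ^ M ≤ ((1 + d) * m) ^ M := by gcongr
    _ = (1 + d) ^ M * m ^ M := mul_pow _ _ _
    _ ≤ _ := by gcongr

theorem eLpNorm_two_le_of_bounded_of_support {f : V → ℂ} {R B : ℝ}
    (h0 : ∀ x ∉ Metric.closedBall (0 : V) R, f x = 0) (hB : ∀ x, ‖f x‖ ≤ B) :
    eLpNorm f 2 ≤ ENNReal.ofReal B *
      volume (Metric.closedBall (0 : V) R) ^ (1 / (2 : ℝ)) := by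
  have h := eLpNorm_indicator_const_le (μ := (volume : Measure V))
    (s := Metric.closedBall (0 : V) R) B 2
  refine le_trans (eLpNorm_mono (g := (Metric.closedBall (0 : V) R).indicator fun _ => B)
    fun x => ?_) (h.trans (le_of_eq ?_))
  · have hB0 : 0 ≤ B := (norm_nonneg _).trans (hB x)
    by_cases hx : x ∈ Metric.closedBall (0 : V) R
    · simpa [hx, abs_of_nonneg hB0, -Metric.mem_closedBall] using hB x
    · simp [h0 x hx, hx, -Metric.mem_closedBall]
  · have hB0 : 0 ≤ B := (norm_nonneg _).trans (hB 0)
    rw [Real.enorm_of_nonneg hB0]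
    simp

theorem memLp_two_inv_one_add_norm_pow {M : ℕ} (hM : Module.finrank ℝ V < 2 * M) :
    MemLp (fun x : V => ((1 + ‖x‖) ^ M)⁻¹) 2 := by
  have hρc : Continuous (fun x : V => ((1 + ‖x‖) ^ M)⁻¹) :=
    Continuous.inv₀ (by fun_prop) fun x => by positivity
  rw [memLp_two_iff_integrable_sq hρc.aestronglyMeasurable]
  have := integrable_one_add_norm (E := V) (μ := volume) (r := 2 * M) (by exact_mod_cast hM)
  refine this.congr (Filter.Eventually.of_forall fun x => ?_)
  have : (2 * M : ℝ) = ((2 * M : ℕ) : ℝ) := by push_cast; ring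
  simp only
  rw [Real.rpow_neg (by positivity), this, Real.rpow_natCast, pow_mul', inv_pow]

theorem eLpNorm_two_fourier_le {f : V → ℂ} {R B : ℝ} (hf : Continuous f)
    (h0 : ∀ x ∉ Metric.closedBall (0 : V) R, f x = 0) (hB : ∀ x, ‖f x‖ ≤ B) :
    eLpNorm (𝓕 f) 2 ≤ ENNReal.ofReal B *
      volume (Metric.closedBall (0 : V) R) ^ (1 / (2 : ℝ)) := by
  have hs : HasCompactSupport f := HasCompactSupport.intro (isCompact_closedBall (0 : V) R) h0
  rw [eLpNorm_fourier_eq (hf.integrable_of_hasCompactSupport hs)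
    (hf.memLp_of_hasCompactSupport hs)]
  exact eLpNorm_two_le_of_bounded_of_support h0 hB

section Weighted

variable {f : V → ℂ} {M : ℕ} {R B : ℝ} (hf : ContDiff ℝ M f)
    (h0 : ∀ x ∉ Metric.closedBall (0 : V) R, f x = 0)
    (hB : ∀ n ≤ M, ∀ x, ‖iteratedFDeriv ℝ n f x‖ ≤ B)

include hf h0

theorem integrable_iteratedFDeriv_of_support {n : ℕ} (hn : n ≤ M) :
    Integrable (iteratedFDeriv ℝ n f) := by
  refine (hf.continuous_iteratedFDeriv (by exact_mod_cast hn)).integrable_of_hasCompactSupport ?_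
  exact HasCompactSupport.intro (isCompact_closedBall (0 : V) R) fun x hx =>
    iteratedFDeriv_eq_zero_of_notMem Metric.isClosed_closedBall h0 n hx

include hB

/-- Multiplying the transform by `(2πi⟨v,x⟩)^M` amounts to differentiating `M` times along `v`, and
Plancherel bounds the result by the size and support of that derivative. -/
theorem eLpNorm_inner_pow_mul_fourier_le (v : V) (hv : ‖v‖ = 1) :
    eLpNorm (fun x => |inner ℝ v x| ^ M * ‖𝓕 f x‖) 2 ≤ ENNReal.ofReal B *
      volume (Metric.closedBall (0 : V) R) ^ (1 / (2 : ℝ)) := by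
  refine le_trans (eLpNorm_mono fun x => ?_) (eLpNorm_two_fourier_le
    (f := fun y => iteratedFDeriv ℝ M f y (fun _ => v)) (R := R) (B := B) ?_ ?_ ?_)
  · rw [fourier_iteratedFDeriv_apply_const hf
      (fun n hn => integrable_iteratedFDeriv_of_support hf h0 hn), norm_mul, norm_pow,
      norm_mul, norm_pow, norm_norm, Real.norm_eq_abs]
    -- The factor `(2π)^M ≥ 1` is dropped.
    refine mul_le_mul_of_nonneg_right (pow_le_pow_left₀ (abs_nonneg _) ?_ M) (norm_nonneg (𝓕 f x))
    simp only [norm_mul, Complex.norm_real, Complex.norm_I, Real.norm_eq_abs, mul_one,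
      Complex.norm_ofNat, abs_of_pos Real.pi_pos]
    rw [abs_abs]
    nlinarith [Real.pi_gt_three, abs_nonneg (inner ℝ v x)]
  · exact (ContinuousMultilinearMap.apply ℝ (fun _ : Fin M => V) ℂ (fun _ => v)).continuous.comp
      (hf.continuous_iteratedFDeriv le_rfl)
  · intro x hx
    rw [iteratedFDeriv_eq_zero_of_notMem Metric.isClosed_closedBall h0 M hx]
    simp
  · intro x
    refine ((iteratedFDeriv ℝ M f x).le_opNorm _).trans ?_
    simpa [hv] using hB M le_rfl x

theorem eLpNorm_one_add_norm_pow_mul_fourier_le :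
    eLpNorm (fun x => (1 + ‖x‖) ^ M * ‖𝓕 f x‖) 2 ≤
      ENNReal.ofReal ((1 + Module.finrank ℝ V) ^ M) * ((1 + Module.finrank ℝ V) *
        (ENNReal.ofReal B * volume (Metric.closedBall (0 : V) R) ^ (1 / (2 : ℝ)))) := by
  have hfi : Integrable f := hf.continuous.integrable_of_hasCompactSupport
    (HasCompactSupport.intro (isCompact_closedBall (0 : V) R) h0)
  have hFc := continuous_fourier_of_integrable hfi
  let b := stdOrthonormalBasis ℝ V
  set S := ENNReal.ofReal B * volume (Metric.closedBall (0 : V) R) ^ (1 / (2 : ℝ))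
  have h1 : ∀ x, ‖(1 + ‖x‖) ^ M * ‖𝓕 f x‖‖ ≤
      ‖((1 + (Module.finrank ℝ V : ℝ)) ^ M •
        ((fun x => ‖𝓕 f x‖) + ∑ i, fun x => |inner ℝ (b i) x| ^ M * ‖𝓕 f x‖)) x‖ := by
    intro x
    rw [Real.norm_of_nonneg (by positivity)]
    refine le_trans ?_ (le_abs_self _)
    simp only [Pi.smul_apply, Pi.add_apply, Finset.sum_apply, smul_eq_mul]
    rw [← Finset.sum_mul]
    have := mul_le_mul_of_nonneg_right (one_add_norm_pow_le b M x) (norm_nonneg (𝓕 f x))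
    linarith
  refine (eLpNorm_mono h1).trans ?_
  rw [eLpNorm_const_smul, Real.enorm_of_nonneg (by positivity)]
  gcongr
  refine (eLpNorm_add_le hFc.norm.aestronglyMeasurable
    (Finset.aestronglyMeasurable_sum _ fun i _ => ?_) (by norm_num)).trans ?_
  · exact Continuous.aestronglyMeasurable (by fun_prop)
  rw [add_mul, one_mul]
  gcongr
  · rw [eLpNorm_norm]
    exact eLpNorm_two_fourier_le hf.continuous h0 fun x => by simpa using hB 0 (Nat.zero_le _) x
  · refine (eLpNorm_sum_le (fun i _ => Continuous.aestronglyMeasurable (by fun_prop))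
      (by norm_num)).trans ?_
    refine (Finset.sum_le_sum fun i _ =>
      eLpNorm_inner_pow_mul_fourier_le hf h0 hB (b i) (b.orthonormal.1 i)).trans ?_
    simp [S]

end Weighted

/-- Bernstein's estimate: the Fourier transform of a compactly supported function with more than
`d / 2` bounded derivatives is integrable. -/
theorem exists_lintegral_fourier_le {M : ℕ} (hM : Module.finrank ℝ V < 2 * M) (R : ℝ) :
    ∃ C : ℝ≥0∞, C ≠ ∞ ∧ ∀ (f : V → ℂ) (B : ℝ), ContDiff ℝ M f →
      (∀ x ∉ Metric.closedBall (0 : V) R, f x = 0) →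
      (∀ n ≤ M, ∀ x, ‖iteratedFDeriv ℝ n f x‖ ≤ B) →
      ∫⁻ x, ‖𝓕 f x‖ₑ ≤ C * ENNReal.ofReal B := by
  have hv : volume (Metric.closedBall (0 : V) R) ^ (1 / (2 : ℝ)) ≠ ∞ :=
    ENNReal.rpow_ne_top_of_nonneg (by norm_num) measure_closedBall_lt_top.ne
  have hρ := memLp_two_inv_one_add_norm_pow hM
  refine ⟨eLpNorm (fun x : V => ((1 + ‖x‖) ^ M)⁻¹) 2 *
    (ENNReal.ofReal ((1 + Module.finrank ℝ V) ^ M) * ((1 + Module.finrank ℝ V) *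
      volume (Metric.closedBall (0 : V) R) ^ (1 / (2 : ℝ)))), ?_, ?_⟩
  · refine ENNReal.mul_ne_top hρ.2.ne (ENNReal.mul_ne_top ENNReal.ofReal_ne_top
      (ENNReal.mul_ne_top ?_ hv))
    exact_mod_cast ENNReal.natCast_ne_top (1 + Module.finrank ℝ V)
  intro f B hf h0 hB
  have hfi : Integrable f := hf.continuous.integrable_of_hasCompactSupport
    (HasCompactSupport.intro (isCompact_closedBall (0 : V) R) h0)
  have hFc := continuous_fourier_of_integrable hfi
  have hpt : ∀ x, ‖𝓕 f x‖ ≤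
      ‖((fun x : V => ((1 + ‖x‖) ^ M)⁻¹) • fun x => (1 + ‖x‖) ^ M * ‖𝓕 f x‖) x‖ := fun x => by
    simp only [Pi.smul_apply', smul_eq_mul]
    rw [inv_mul_cancel_left₀ (by positivity)]
    simp
  have hm : AEStronglyMeasurable (fun x => (1 + ‖x‖) ^ M * ‖𝓕 f x‖) volume :=
    Continuous.aestronglyMeasurable (by fun_prop)
  -- Cauchy–Schwarz against the weight `(1+‖x‖)^(-M)`, which is square integrable exactly because
  -- `M` exceeds half the dimension.
  have h2 := eLpNorm_smul_le_mul_eLpNorm (p := 2) (q := 2) (r := 1) hm hρ.1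
  refine eLpNorm_one_eq_lintegral_enorm.ge.trans ((eLpNorm_mono hpt).trans (h2.trans ?_))
  refine (mul_le_mul_right (eLpNorm_one_add_norm_pow_mul_fourier_le hf h0 hB) _).trans
    (le_of_eq ?_)
  ring

end FourierEstimates

/-! ### Sums of band-limited functions over separated points -/

section Sampling

open FourierTransform

variable {V : Type*} [NormedAddCommGroup V] [InnerProductSpace ℝ V] [FiniteDimensional ℝ V]
  [MeasurableSpace V] [BorelSpace V]

theorem lintegral_inv_one_add_norm_pow_lt_top {k : ℕ} (hk : Module.finrank ℝ V < k) :
    ∫⁻ x : V, ENNReal.ofReal ((1 + ‖x‖) ^ k)⁻¹ < ∞ := by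
  have := finite_integral_one_add_norm (E := V) (μ := volume) (r := k) (by exact_mod_cast hk)
  simpa only [Real.rpow_neg (add_nonneg zero_le_one (norm_nonneg _)), Real.rpow_natCast] using this

/-- Sums of a decaying weight over separated points are bounded by the separation. -/
theorem exists_sum_inv_one_add_norm_pow_le {k : ℕ} (hk : Module.finrank ℝ V < k) {δ : ℝ}
    (hδ : 0 < δ) : ∃ C : ℝ≥0∞, C ≠ ∞ ∧ ∀ (N : ℕ) (z : Fin N → V),
      (∀ i j, i ≠ j → δ ≤ dist (z i) (z j)) → ∀ y,
        ∑ j, ENNReal.ofReal ((1 + ‖y - z j‖) ^ k)⁻¹ ≤ C := by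
  set v : ℝ≥0∞ := volume (Metric.ball (0 : V) (δ / 2)) with hv
  have hv0 : v ≠ 0 := (Metric.measure_ball_pos _ _ (by positivity)).ne'
  have hvt : v ≠ ∞ := measure_ball_lt_top.ne
  set I : ℝ≥0∞ := ∫⁻ x : V, ENNReal.ofReal ((1 + ‖x‖) ^ k)⁻¹
  have hI : I < ∞ := lintegral_inv_one_add_norm_pow_lt_top hk
  set c : ℝ≥0∞ := ENNReal.ofReal ((1 + δ / 2) ^ k)
  refine ⟨c * I / v, ENNReal.div_ne_top (ENNReal.mul_ne_top ENNReal.ofReal_ne_top hI.ne) hv0, ?_⟩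
  intro N z hz y
  rw [ENNReal.le_div_iff_mul_le (Or.inl hv0) (Or.inl hvt), Finset.sum_mul]
  -- The weight varies by at most the factor `(1+δ/2)^k` on a ball of radius `δ/2`, so each value is
  -- dominated by an integral over such a ball; separation makes the balls disjoint.
  have hpt : ∀ j, ENNReal.ofReal ((1 + ‖y - z j‖) ^ k)⁻¹ * v ≤
      ∫⁻ x in Metric.ball (z j) (δ / 2), c * ENNReal.ofReal ((1 + ‖x - y‖) ^ k)⁻¹ := by
    intro j
    rw [hv, ← Measure.addHaar_ball_center volume (z j), ← setLIntegral_const]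
    refine setLIntegral_mono' measurableSet_ball fun x hx => ?_
    rw [← ENNReal.ofReal_mul (by positivity)]
    refine ENNReal.ofReal_le_ofReal ?_
    rw [← div_eq_mul_inv, inv_le_comm₀ (by positivity) (by positivity), inv_div,
      div_le_iff₀ (by positivity), ← mul_pow]
    refine pow_le_pow_left₀ (by positivity) ?_ k
    have h1 : ‖x - y‖ ≤ ‖y - z j‖ + δ / 2 := by
      rw [Metric.mem_ball] at hx
      have := dist_triangle x (z j) y
      rw [← dist_eq_norm, ← dist_eq_norm, dist_comm y]
      linarith
    nlinarith [norm_nonneg (y - z j)]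
  calc ∑ j, ENNReal.ofReal ((1 + ‖y - z j‖) ^ k)⁻¹ * v
      ≤ ∑ j, ∫⁻ x in Metric.ball (z j) (δ / 2), c * ENNReal.ofReal ((1 + ‖x - y‖) ^ k)⁻¹ :=
        Finset.sum_le_sum fun j _ => hpt j
    _ = ∫⁻ x in ⋃ j, Metric.ball (z j) (δ / 2), c * ENNReal.ofReal ((1 + ‖x - y‖) ^ k)⁻¹ := by
        rw [lintegral_iUnion (fun j => measurableSet_ball), tsum_fintype]
        intro i j hij
        refine Metric.ball_disjoint_ball ?_
        linarith [hz i j hij]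
    _ ≤ ∫⁻ x, c * ENNReal.ofReal ((1 + ‖x - y‖) ^ k)⁻¹ := setLIntegral_le_lintegral _ _
    _ = c * I := by
        rw [lintegral_sub_right_eq_self (fun x => c * ENNReal.ofReal ((1 + ‖x‖) ^ k)⁻¹) y,
          lintegral_const_mul _ (by fun_prop)]

omit [FiniteDimensional ℝ V] [MeasurableSpace V] [BorelSpace V] in
theorem SchwartzMap.exists_norm_le_inv_one_add_norm_pow (θ : 𝓢(V, ℂ)) (k : ℕ) :
    ∃ c : ℝ, 0 ≤ c ∧ ∀ x, ‖θ x‖ ≤ c * ((1 + ‖x‖) ^ k)⁻¹ := by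
  refine ⟨2 ^ k * ((Finset.Iic ((k, 0) : ℕ × ℕ)).sup fun m => SchwartzMap.seminorm ℝ m.1 m.2) θ,
    by positivity, fun x => ?_⟩
  have h := SchwartzMap.one_add_le_sup_seminorm_apply (𝕜 := ℝ) (m := (k, 0)) le_rfl le_rfl θ x
  rw [norm_iteratedFDeriv_zero] at h
  rw [← div_eq_mul_inv, le_div_iff₀ (by positivity), mul_comm]
  exact h

omit [MeasurableSpace V] [BorelSpace V] in
theorem exists_schwartz_eq_one_on_closedBall (R : ℝ) :
    ∃ χ : 𝓢(V, ℂ), ∀ x ∈ Metric.closedBall (0 : V) R, χ x = 1 := by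
  let b : ContDiffBump (0 : V) := ⟨|R| + 1, |R| + 2, by positivity, by linarith⟩
  have hs : HasCompactSupport (fun x => (b x : ℂ)) :=
    b.hasCompactSupport.comp_left Complex.ofReal_zero
  refine ⟨hs.toSchwartzMap (Complex.ofRealCLM.contDiff.comp b.contDiff), fun x hx => ?_⟩
  have : b x = 1 := b.one_of_mem_closedBall
    (Metric.closedBall_subset_closedBall ((le_abs_self R).trans (by simp [b])) hx)
  change ((b x : ℝ) : ℂ) = 1
  simp [this]

theorem fourier_mul_fourierChar {f : V → ℂ} (z y : V) :
    𝓕 (fun ω => (Real.fourierChar (-inner ℝ ω z) : ℂ) * f ω) y = 𝓕 f (y + z) := by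
  rw [Real.fourier_eq, Real.fourier_eq]
  refine integral_congr_ae (Filter.Eventually.of_forall fun ω => ?_)
  simp only [Circle.smul_def, smul_eq_mul, inner_add_right, neg_add, AddChar.map_add_eq_mul,
    Circle.coe_mul]
  ring

/-- The reproducing formula for functions with compactly supported Fourier transform. -/
theorem fourier_eq_integral_fourierInv_mul {f : V → ℂ} {R : ℝ} (hf : Continuous f)
    (h0 : ∀ x ∉ Metric.closedBall (0 : V) R, f x = 0) (hF : Integrable (𝓕 f)) {χ : 𝓢(V, ℂ)}
    (hχ : ∀ x ∈ Metric.closedBall (0 : V) R, χ x = 1) (z : V) :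
    𝓕 f z = ∫ y, 𝓕⁻ f y * 𝓕 (fun ω => χ ω) (y + z) := by
  have hfi : Integrable f := hf.integrable_of_hasCompactSupport
    (HasCompactSupport.intro (isCompact_closedBall (0 : V) R) h0)
  have hF' : Integrable (𝓕⁻ f) := by
    have : 𝓕⁻ f = fun y => 𝓕 f (-y) := funext fun y => Real.fourierInv_eq_fourier_neg f y
    rw [this]
    exact hF.comp_neg
  have hχi : Integrable (fun ω => (Real.fourierChar (-inner ℝ ω z) : ℂ) * χ ω) := by
    have := (Real.fourierIntegral_convergent_iff (μ := volume) (f := fun ω => χ ω) z).2 χ.integrable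
    simpa only [Circle.smul_def, smul_eq_mul] using this
  -- Since `χ f = f` and `f = 𝓕 (𝓕⁻ f)`, the outer transform can be moved onto the modulated
  -- cut-off.
  have h1 := integral_fourier_mul_eq_mul_fourier hF' hχi
  simp only [fourier_mul_fourierChar] at h1
  rw [← h1, hf.fourier_fourierInv_eq hfi hF, Real.fourier_eq]
  refine integral_congr_ae (Filter.Eventually.of_forall fun ω => ?_)
  simp only [Circle.smul_def, smul_eq_mul]
  by_cases hω : ω ∈ Metric.closedBall (0 : V) R
  · rw [hχ ω hω]; ring
  · rw [h0 ω hω]; ring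

/-- Plancherel–Pólya type inequality: the values of a band-limited integrable function at separated
points are summable, uniformly. -/
theorem exists_sum_fourier_le (R : ℝ) {δ : ℝ} (hδ : 0 < δ) :
    ∃ C : ℝ≥0∞, C ≠ ∞ ∧ ∀ (f : V → ℂ), Continuous f →
      (∀ x ∉ Metric.closedBall (0 : V) R, f x = 0) → Integrable (𝓕 f) →
      ∀ (N : ℕ) (z : Fin N → V), (∀ i j, i ≠ j → δ ≤ dist (z i) (z j)) → ∀ y,
        ∑ j, ‖𝓕 f (y - z j)‖ₑ ≤ C * ∫⁻ x, ‖𝓕 f x‖ₑ := by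
  obtain ⟨χ, hχ⟩ := exists_schwartz_eq_one_on_closedBall (V := V) R
  set k := Module.finrank ℝ V + 1
  obtain ⟨c, hc0, hc⟩ := SchwartzMap.exists_norm_le_inv_one_add_norm_pow (𝓕 χ) k
  obtain ⟨C, hCt, hC⟩ := exists_sum_inv_one_add_norm_pow_le (V := V) (Nat.lt_succ_self _) hδ
  refine ⟨ENNReal.ofReal c * C, ENNReal.mul_ne_top ENNReal.ofReal_ne_top hCt, ?_⟩
  intro f hf h0 hF N z hz y
  have hχe : ∀ x, ‖𝓕 (fun ω => χ ω) x‖ₑ ≤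
      ENNReal.ofReal c * ENNReal.ofReal ((1 + ‖x‖) ^ k)⁻¹ := fun x => by
    rw [← ENNReal.ofReal_mul hc0, ← ofReal_norm, ← SchwartzMap.fourier_coe]
    exact ENNReal.ofReal_le_ofReal (hc x)
  have hχc : Continuous (𝓕 fun ω => χ ω) := continuous_fourier_of_integrable χ.integrable
  have hfi : Integrable f := hf.integrable_of_hasCompactSupport
    (HasCompactSupport.intro (isCompact_closedBall (0 : V) R) h0)
  have hFc : Continuous (𝓕⁻ f) := by
    have : 𝓕⁻ f = fun y => 𝓕 f (-y) := funext fun y => Real.fourierInv_eq_fourier_neg f y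
    rw [this]
    exact (continuous_fourier_of_integrable hfi).comp continuous_neg
  calc ∑ j, ‖𝓕 f (y - z j)‖ₑ
      ≤ ∑ j, ∫⁻ x, ‖𝓕⁻ f x‖ₑ * ‖𝓕 (fun ω => χ ω) (x + (y - z j))‖ₑ := by
        refine Finset.sum_le_sum fun j _ => ?_
        rw [fourier_eq_integral_fourierInv_mul hf h0 hF hχ]
        refine (enorm_integral_le_lintegral_enorm _).trans (le_of_eq ?_)
        simp only [enorm_mul]
    _ = ∫⁻ x, ‖𝓕⁻ f x‖ₑ * ∑ j, ‖𝓕 (fun ω => χ ω) (x + (y - z j))‖ₑ := by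
        rw [← lintegral_finsetSum _ fun j _ => by fun_prop]
        simp only [Finset.mul_sum]
    -- All dependence on the points now sits in the Schwartz function `𝓕 χ`, whose sums over
    -- separated translates are uniformly bounded.
    _ ≤ ∫⁻ x, ‖𝓕⁻ f x‖ₑ * (ENNReal.ofReal c * C) := by
        refine lintegral_mono fun x => mul_le_mul_right ?_ _
        refine (Finset.sum_le_sum fun j _ => hχe _).trans ?_
        rw [← Finset.mul_sum]
        refine mul_le_mul_right (le_trans (le_of_eq ?_) (hC N z hz (x + y))) _
        simp only [add_sub_assoc, k]
    _ = ENNReal.ofReal c * C * ∫⁻ x, ‖𝓕 f x‖ₑ := by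
        rw [lintegral_mul_const _ (by fun_prop), mul_comm]
        congr 1
        simp only [Real.fourierInv_eq_fourier_neg]
        exact lintegral_neg_eq_self (fun x => ‖𝓕 f x‖ₑ)

end Sampling

/-! ### Uniform derivative bounds for symbols on the unit annulus -/

section SymbolBounds

variable {E F G : Type*} [NormedAddCommGroup E] [NormedSpace ℝ E] [NormedAddCommGroup F]
  [NormedSpace ℝ F] [NormedAddCommGroup G] [NormedSpace ℝ G]

theorem exists_norm_iteratedFDeriv_le_of_isCompact {M : ℕ} {f : E → F} {O K : Set E}
    (hO : IsOpen O) (hf : ContDiffOn ℝ M f O) (hK : IsCompact K) (hKO : K ⊆ O) :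
    ∃ B : ℝ, 0 ≤ B ∧ ∀ n ≤ M, ∀ x ∈ K, ‖iteratedFDeriv ℝ n f x‖ ≤ B := by
  have h : ∀ n, ∃ B : ℝ, n ≤ M → ∀ x ∈ K, ‖iteratedFDeriv ℝ n f x‖ ≤ B := by
    intro n
    by_cases hn : n ≤ M
    · have hc : ContinuousOn (iteratedFDeriv ℝ n f) K :=
        (((hf.continuousOn_iteratedFDerivWithin (by exact_mod_cast hn) hO.uniqueDiffOn).congr
          fun x hx => ((iteratedFDerivWithin_of_isOpen n hO) hx).symm)).mono hKO
      obtain ⟨B, hB⟩ := hK.exists_bound_of_continuousOn hc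
      exact ⟨B, fun _ => hB⟩
    · exact ⟨0, fun h => absurd h hn⟩
  choose B hB using h
  refine ⟨∑ n ∈ Finset.range (M + 1), |B n|, Finset.sum_nonneg fun _ _ => abs_nonneg _, ?_⟩
  intro n hn x hx
  refine (hB n hn x hx).trans ((le_abs_self _).trans ?_)
  exact Finset.single_le_sum (f := fun n => |B n|) (fun _ _ => abs_nonneg _)
    (Finset.mem_range.2 (Nat.lt_succ_of_le hn))

theorem norm_iteratedFDeriv_comp_le_of_isOpen {g : F → G} {f : E → F} {M n : ℕ} {s : Set E}
    {t : Set F} (hs : IsOpen s) (ht : IsOpen t) (hst : Set.MapsTo f s t)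
    (hg : ContDiffOn ℝ M g t) (hf : ContDiffOn ℝ M f s) (hn : n ≤ M) {x : E} (hx : x ∈ s)
    {C D : ℝ} (hC : ∀ i ≤ n, ‖iteratedFDeriv ℝ i g (f x)‖ ≤ C)
    (hD : ∀ i, 1 ≤ i → i ≤ n → ‖iteratedFDeriv ℝ i f x‖ ≤ D ^ i) :
    ‖iteratedFDeriv ℝ n (g ∘ f) x‖ ≤ n.factorial * C * D ^ n := by
  rw [← iteratedFDerivWithin_of_isOpen n hs hx]
  refine norm_iteratedFDerivWithin_comp_le hg hf (by exact_mod_cast hn) ht.uniqueDiffOn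
    hs.uniqueDiffOn hst hx (fun i hi => ?_) (fun i h1 hi => ?_)
  · rw [iteratedFDerivWithin_of_isOpen i ht (hst hx)]
    exact hC i hi
  · rw [iteratedFDerivWithin_of_isOpen i hs hx]
    exact hD i h1 hi

theorem norm_iteratedFDeriv_smul_le_of_isOpen {f : E → ℝ} {g : E → F} {M n : ℕ} {s : Set E}
    (hs : IsOpen s) (hf : ContDiffOn ℝ M f s) (hg : ContDiffOn ℝ M g s) (hn : n ≤ M) {x : E}
    (hx : x ∈ s) {A B : ℝ} (hA : ∀ i ≤ n, ‖iteratedFDeriv ℝ i f x‖ ≤ A)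
    (hB : ∀ i ≤ n, ‖iteratedFDeriv ℝ i g x‖ ≤ B) :
    ‖iteratedFDeriv ℝ n (fun y => f y • g y) x‖ ≤ 2 ^ n * (A * B) := by
  have hA0 : 0 ≤ A := (norm_nonneg _).trans (hA 0 (Nat.zero_le _))
  rw [← iteratedFDerivWithin_of_isOpen n hs hx]
  refine (norm_iteratedFDerivWithin_smul_le hf hg hs.uniqueDiffOn hx
    (by exact_mod_cast hn)).trans ?_
  have : (2 : ℝ) ^ n = ∑ i ∈ Finset.range (n + 1), (n.choose i : ℝ) := by
    exact_mod_cast (Nat.sum_range_choose n).symm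
  rw [this, Finset.sum_mul]
  refine Finset.sum_le_sum fun i hi => ?_
  have hi' : i ≤ n := Nat.lt_succ_iff.1 (Finset.mem_range.1 hi)
  rw [iteratedFDerivWithin_of_isOpen i hs hx, iteratedFDerivWithin_of_isOpen (n - i) hs hx,
    mul_assoc]
  gcongr
  · exact hA i hi'
  · exact hB _ (Nat.sub_le _ _)

/-- The map is affine: its derivative is the constant inclusion, of norm at most one, and the higher
derivatives vanish. It serves to restrict joint bounds in `(t, x)` to slices. -/
theorem norm_iteratedFDeriv_prodMk_left_le (t : F) (x : E) {i : ℕ} (hi : 1 ≤ i) :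
    ‖iteratedFDeriv ℝ i (fun y : E => (t, y)) x‖ ≤ 1 := by
  obtain ⟨j, rfl⟩ := Nat.exists_eq_add_of_le' hi
  have h : fderiv ℝ (fun y : E => (t, y)) = fun _ => ContinuousLinearMap.inr ℝ F E :=
    funext fun y => ((hasFDerivAt_prodMk_right t y).fderiv)
  rw [← norm_iteratedFDeriv_fderiv, h]
  rcases Nat.eq_zero_or_pos j with rfl | hj
  · simpa using ContinuousLinearMap.norm_inr_le_one ℝ F E
  · rw [iteratedFDeriv_const_of_ne hj.ne']
    simp

variable {V : Type*} [NormedAddCommGroup V] [InnerProductSpace ℝ V] [FiniteDimensional ℝ V]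

/-- The closed annulus `1/2 ≤ ‖ω‖ ≤ 2`. -/
def unitAnnulus (V : Type*) [NormedAddCommGroup V] : Set V := {ω | 1 / 2 ≤ ‖ω‖ ∧ ‖ω‖ ≤ 2}

omit [InnerProductSpace ℝ V] [FiniteDimensional ℝ V] in
theorem isClosed_unitAnnulus : IsClosed (unitAnnulus V) :=
  (isClosed_le continuous_const continuous_norm).inter
    (isClosed_le continuous_norm continuous_const)

theorem isCompact_unitAnnulus : IsCompact (unitAnnulus V) :=
  (isCompact_closedBall (0 : V) 2).of_isClosed_subset isClosed_unitAnnulus fun ω hω => by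
    simpa using hω.2

/-- Uniform bounds for the derivatives of `ω ↦ (t + ‖ω‖²)^e η(ω)` on the unit annulus. -/
theorem exists_norm_iteratedFDeriv_rpow_smul_le (e : ℝ) (M : ℕ) {η : V → ℂ}
    (hη : ContDiff ℝ M η) : ∃ B : ℝ, 0 ≤ B ∧ ∀ t ∈ Set.Icc (0 : ℝ) 1, ∀ n ≤ M,
      ∀ ω ∈ unitAnnulus V, ‖iteratedFDeriv ℝ n (fun ω => (t + ‖ω‖ ^ 2) ^ e • η ω) ω‖ ≤ B := by
  -- Uniformity in `t` comes from treating `t` as one more variable: a single compactness argument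
  -- on `[0,1] ×` annulus bounds all slices.
  let O : Set (ℝ × V) := {p | 0 < p.1 + ‖p.2‖ ^ 2}
  have hO : IsOpen O := isOpen_lt continuous_const (by fun_prop)
  let J : ℝ × V → ℂ := fun p => (p.1 + ‖p.2‖ ^ 2) ^ e • η p.2
  have hJ : ContDiffOn ℝ M J O := by
    refine ContDiffOn.smul (ContDiffOn.rpow_const_of_ne ?_ fun p hp => ne_of_gt hp)
      (hη.comp contDiff_snd).contDiffOn
    exact (contDiff_fst.add (contDiff_snd.norm_sq ℝ)).contDiffOn
  have hK : IsCompact (Set.Icc (0 : ℝ) 1 ×ˢ unitAnnulus V) :=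
    isCompact_Icc.prod isCompact_unitAnnulus
  have hKO : Set.Icc (0 : ℝ) 1 ×ˢ unitAnnulus V ⊆ O := by
    rintro ⟨t, ω⟩ ⟨⟨ht, -⟩, hω, -⟩
    simp only [O, Set.mem_ofPred_eq] at ht hω ⊢
    have : 0 < ‖ω‖ := by linarith
    positivity
  obtain ⟨B, hB0, hB⟩ := exists_norm_iteratedFDeriv_le_of_isCompact hO hJ hK hKO
  refine ⟨M.factorial * B, by positivity, fun t ht n hn ω hω => ?_⟩
  let ι : V → ℝ × V := fun ω => (t, ω)
  have hι : ContDiff ℝ M ι := contDiff_const.prodMk contDiff_id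
  have h := norm_iteratedFDeriv_comp_le_of_isOpen (g := J) (f := ι) (hO.preimage hι.continuous) hO
    (Set.mapsTo_preimage _ _) hJ hι.contDiffOn hn (x := ω) (hKO ⟨ht, hω⟩)
    (fun i hi => hB i (hi.trans hn) (t, ω) ⟨ht, hω⟩)
    (D := 1) (fun i h1 _ => by
      rw [one_pow]; exact norm_iteratedFDeriv_prodMk_left_le t ω h1)
  refine h.trans ?_
  rw [one_pow, mul_one]
  gcongr

/-- Uniform bounds for the derivatives of radial functions on the unit annulus. -/
theorem exists_norm_iteratedFDeriv_comp_norm_le (M : ℕ) : ∃ c : ℝ, 0 ≤ c ∧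
    ∀ (f : ℝ → ℝ) (r B : ℝ), 0 ≤ r → r < 1 / 2 → ContDiffOn ℝ M f (Set.Ioi r) →
      (∀ n ≤ M, ∀ x, 1 / 2 ≤ x → |iteratedDeriv n f x| ≤ B) →
      ∀ n ≤ M, ∀ ω ∈ unitAnnulus V, ‖iteratedFDeriv ℝ n (fun ω : V => f ‖ω‖) ω‖ ≤ c * B := by
  have hnorm : ContDiffOn ℝ M (fun ω : V => ‖ω‖) {0}ᶜ := contDiffOn_id.norm ℝ fun x hx => hx
  obtain ⟨D, hD0, hD⟩ := exists_norm_iteratedFDeriv_le_of_isCompact isOpen_compl_singleton hnorm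
    isCompact_unitAnnulus (fun ω hω h0 => by
      have : ω = 0 := h0
      have h := hω.1
      rw [this, norm_zero] at h
      norm_num at h)
  refine ⟨M.factorial * (1 + D) ^ M, by positivity, ?_⟩
  intro f r B hr0 hr hf hB n hn ω hω
  have hB0 : 0 ≤ B := (abs_nonneg _).trans (hB 0 (Nat.zero_le _) (1 / 2) le_rfl)
  have hs : IsOpen {ω : V | r < ‖ω‖} := isOpen_lt continuous_const continuous_norm
  have h := norm_iteratedFDeriv_comp_le_of_isOpen (g := f) (f := fun ω : V => ‖ω‖) hs isOpen_Ioi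
    (fun ω hω => hω) hf (hnorm.mono fun ω hω h0 => by
      have : ω = 0 := h0
      simp only [this, Set.mem_ofPred_eq, norm_zero] at hω
      -- The composition bound needs `i`-th derivatives of the norm below an `i`-th power; `1 + D ≥
      -- 1` makes one base serve for every `i ≥ 1`.
      linarith) hn (x := ω) (lt_of_lt_of_le hr hω.1) (C := B) (D := 1 + D)
    (fun i hi => by
      rw [norm_iteratedFDeriv_eq_norm_iteratedDeriv]
      exact hB i (hi.trans hn) _ hω.1)
    (fun i h1 hi => by
      refine (hD i (hi.trans hn) ω hω).trans ?_
      calc D ≤ 1 + D := by linarith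
        _ ≤ (1 + D) ^ i := le_self_pow₀ (by linarith) (by omega))
  refine h.trans ?_
  have h1 : (1 + D) ^ n ≤ (1 + D) ^ M := pow_le_pow_right₀ (by linarith) hn
  calc (n.factorial : ℝ) * B * (1 + D) ^ n ≤ M.factorial * B * (1 + D) ^ M := by gcongr
    _ = _ := by ring

/-- The localized symbol `(s⁻² + ‖ω‖²)^e F(s ‖ω‖) η(ω)`. -/
def localizedSymbol (e : ℝ) (F : ℝ → ℝ) (η : V → ℂ) (s : ℝ) (ω : V) : ℂ :=
  F (s * ‖ω‖) • ((s⁻¹ ^ 2 + ‖ω‖ ^ 2) ^ e • η ω)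

omit [InnerProductSpace ℝ V] [FiniteDimensional ℝ V] in
theorem localizedSymbol_eq_zero {e : ℝ} {F : ℝ → ℝ} {η : V → ℂ}
    (hη0 : ∀ ω ∉ unitAnnulus V, η ω = 0) (s : ℝ) {ω : V} (hω : ω ∉ unitAnnulus V) :
    localizedSymbol e F η s ω = 0 := by
  simp [localizedSymbol, hη0 ω hω]

/-- For `s > 1` the dilation makes `F(s·)` smooth on an open neighbourhood of `[1/2, ∞)`, so
one-sided derivatives at the endpoint `1/2` are ordinary derivatives. -/
theorem contDiffOn_comp_mul {F : ℝ → ℝ} {M : ℕ} {s : ℝ} (hs : 1 < s)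
    (hF : ContDiffOn ℝ M F (Set.Ici (1 / 2))) :
    ContDiffOn ℝ M (fun x => F (s * x)) (Set.Ioi (1 / (2 * s))) := by
  refine hF.comp (by fun_prop) fun x hx => ?_
  have : 1 / (2 * s) < x := hx
  rw [div_lt_iff₀ (by positivity)] at this
  simp only [Set.mem_Ici]
  linarith

/-- On the annulus this is Leibniz' rule applied to the radial factor and the power factor, the
latter with parameter `t = s⁻² ∈ [0,1]`; off the annulus the symbol vanishes locally. -/
theorem exists_norm_iteratedFDeriv_localizedSymbol_le (e : ℝ) {F : ℝ → ℝ} {M : ℕ} {C : ℝ}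
    {η : V → ℂ} (hη : ContDiff ℝ M η) (hη0 : ∀ ω ∉ unitAnnulus V, η ω = 0)
    (hF : ContDiffOn ℝ M F (Set.Ici (1 / 2)))
    (hFB : ∀ s, 1 < s → ∀ n ≤ M, ∀ x : ℝ, 1 / 2 ≤ x →
      |iteratedDerivWithin n (fun x => F (s * x)) (Set.Ici (1 / 2)) x| ≤ C) :
    ∃ B : ℝ, ∀ s, 1 < s → ContDiff ℝ M (localizedSymbol e F η s) ∧
      ∀ n ≤ M, ∀ ω, ‖iteratedFDeriv ℝ n (localizedSymbol e F η s) ω‖ ≤ B := by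
  obtain ⟨A, hA0, hA⟩ := exists_norm_iteratedFDeriv_rpow_smul_le e M hη
  obtain ⟨c, hc0, hc⟩ := exists_norm_iteratedFDeriv_comp_norm_le (V := V) M
  have hC0 : 0 ≤ C := (abs_nonneg _).trans (hFB 2 (by norm_num) 0 (Nat.zero_le _) (1 / 2) le_rfl)
  refine ⟨2 ^ M * (c * C * A), fun s hs => ?_⟩
  set r := 1 / (2 * s) with hr
  have hr0 : 0 < r := by positivity
  have hr2 : r < 1 / 2 := by
    rw [hr, div_lt_div_iff₀ (by positivity) (by norm_num)]; linarith
  have hFs : ContDiffOn ℝ M (fun x => F (s * x)) (Set.Ioi r) := contDiffOn_comp_mul hs hF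
  have hs1 : s⁻¹ ^ 2 ∈ Set.Icc (0 : ℝ) 1 :=
    ⟨by positivity, pow_le_one₀ (by positivity) (inv_le_one_of_one_le₀ hs.le)⟩
  set U : Set V := {ω : V | r < ‖ω‖}
  have hU : IsOpen U := isOpen_lt continuous_const continuous_norm
  have hU0 : ∀ ω ∈ U, ω ≠ 0 := fun ω hω h0 => by
    simp only [U, h0, Set.mem_ofPred_eq, norm_zero] at hω
    linarith
  have hf1 : ContDiffOn ℝ M (fun ω : V => F (s * ‖ω‖)) U :=
    hFs.comp (contDiffOn_id.norm ℝ hU0) fun ω hω => hω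
  have hf2 : ContDiffOn ℝ M (fun ω : V => (s⁻¹ ^ 2 + ‖ω‖ ^ 2) ^ e • η ω) U := by
    refine ContDiffOn.smul (ContDiffOn.rpow_const_of_ne ?_ fun ω hω => ?_) hη.contDiffOn
    · exact (contDiff_const.add (contDiff_id.norm_sq ℝ)).contDiffOn
    · have := norm_pos_iff.2 (hU0 ω hω)
      positivity
  have hFB' : ∀ n ≤ M, ∀ x, 1 / 2 ≤ x → |iteratedDeriv n (fun x => F (s * x)) x| ≤ C := by
    intro n hn x hx
    have hat : ContDiffAt ℝ n (fun x => F (s * x)) x :=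
      (hFs.contDiffAt (Ioi_mem_nhds (hr2.trans_le hx))).of_le (by exact_mod_cast hn)
    rw [← iteratedDerivWithin_eq_iteratedDeriv (uniqueDiffOn_Ici (1 / 2 : ℝ)) hat hx]
    exact hFB s hs n hn x hx
  refine ⟨contDiff_iff_contDiffAt.2 fun ω => ?_, fun n hn ω => ?_⟩
  · by_cases hω : ω ∈ unitAnnulus V
    · exact (hf1.smul hf2).contDiffAt (hU.mem_nhds (hr2.trans_le hω.1))
    · have : localizedSymbol e F η s =ᶠ[nhds ω] fun _ => 0 := by
        filter_upwards [isClosed_unitAnnulus.isOpen_compl.mem_nhds hω] with y hy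
          using localizedSymbol_eq_zero hη0 s hy
      exact contDiffAt_const.congr_of_eventuallyEq this
  · by_cases hω : ω ∈ unitAnnulus V
    · refine (norm_iteratedFDeriv_smul_le_of_isOpen hU hf1 hf2 hn (hr2.trans_le hω.1)
        (fun i hi => hc (fun x => F (s * x)) r C hr0.le hr2 hFs hFB' i (hi.trans hn) ω hω)
        (fun i hi => hA _ hs1 i (hi.trans hn) ω hω)).trans ?_
      gcongr
      norm_num
    · rw [iteratedFDeriv_eq_zero_of_notMem isClosed_unitAnnulus
        (fun x hx => localizedSymbol_eq_zero hη0 s hx) n hω, norm_zero]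
      positivity

end SymbolBounds

/-! ### Dyadic decomposition and scaling of the high-frequency symbol -/

section DyadicSum

open FourierTransform

variable {V : Type*} [NormedAddCommGroup V] [InnerProductSpace ℝ V]

/-- The symbol `F(‖ω‖) (1 + ‖ω‖²)^e θ(ω)`. -/
def radialSymbol (e : ℝ) (F : ℝ → ℝ) (θ : V → ℂ) (ω : V) : ℂ :=
  F ‖ω‖ • ((1 + ‖ω‖ ^ 2) ^ e • θ ω)

/-- The dyadic difference `κ(ω/2) - κ(ω)` of a cut-off function. -/
def dyadicDiff (κ : V → ℂ) (ω : V) : ℂ := κ ((2⁻¹ : ℝ) • ω) - κ ω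

theorem dyadicDiff_eq_zero {κ : V → ℂ} (h1 : ∀ ω, ‖ω‖ ≤ 1 / 2 → κ ω = 1)
    (h0 : ∀ ω, 1 ≤ ‖ω‖ → κ ω = 0) {ω : V} (hω : ω ∉ unitAnnulus V) : dyadicDiff κ ω = 0 := by
  have hn : ‖(2⁻¹ : ℝ) • ω‖ = ‖ω‖ / 2 := by rw [norm_smul]; norm_num; ring
  by_cases h : ‖ω‖ ≤ 1 / 2
  · rw [dyadicDiff, h1 ω h, h1 _ (by rw [hn]; linarith [norm_nonneg ω]), sub_self]
  · have h2 : 2 < ‖ω‖ := by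
      by_contra h3
      exact hω ⟨by linarith, by linarith⟩
    rw [dyadicDiff, h0 ω (by linarith), h0 _ (by rw [hn]; linarith), sub_self]

/-- The series telescopes, and at a fixed `ω` only finitely many terms are nonzero because `κ = 1`
near the origin. -/
theorem hasSum_dyadicDiff {κ : V → ℂ} (h1 : ∀ ω, ‖ω‖ ≤ 1 / 2 → κ ω = 1) {σ : ℝ} (hσ : 0 < σ)
    (ω : V) :
    HasSum (fun n : ℕ => dyadicDiff κ ((2 ^ n * σ)⁻¹ • ω)) (1 - κ (σ⁻¹ • ω)) := by
  obtain ⟨N, hN⟩ := pow_unbounded_of_one_lt (2 * ‖ω‖ / σ) (one_lt_two (α := ℝ))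
  have hterm : ∀ n : ℕ, dyadicDiff κ ((2 ^ n * σ)⁻¹ • ω) =
      κ ((2 ^ (n + 1) * σ)⁻¹ • ω) - κ ((2 ^ n * σ)⁻¹ • ω) := fun n => by
    rw [dyadicDiff, smul_smul]
    congr 3
    rw [pow_succ]
    field_simp
  have hone : ∀ n, N ≤ n → κ ((2 ^ n * σ)⁻¹ • ω) = 1 := fun n hn => by
    refine h1 _ ?_
    rw [norm_smul, Real.norm_of_nonneg (by positivity), ← div_eq_inv_mul,
      div_le_iff₀ (by positivity)]
    have h3 : (2 : ℝ) ^ N ≤ 2 ^ n := pow_le_pow_right₀ one_le_two hn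
    rw [div_lt_iff₀ hσ] at hN
    nlinarith
  have hs : ∑ n ∈ Finset.range N, dyadicDiff κ ((2 ^ n * σ)⁻¹ • ω) = 1 - κ (σ⁻¹ • ω) := by
    simp only [hterm]
    rw [Finset.sum_range_sub (fun n => κ ((2 ^ n * σ)⁻¹ • ω)), hone N le_rfl]
    simp
  rw [← hs]
  refine hasSum_sum_of_ne_finset_zero fun n hn => ?_
  have hn' : N ≤ n := by simpa using hn
  rw [hterm, hone n hn', hone (n + 1) (by omega), sub_self]

/-- Homogeneity: `1 + ‖ω‖² = s² (s⁻² + ‖ω/s‖²)`. The whole size of a piece at scale `s` is thus in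
the factor `s^(2e)`. -/
theorem radialSymbol_eq_localizedSymbol (e : ℝ) (F : ℝ → ℝ) (η : V → ℂ) {s : ℝ} (hs : 0 < s)
    (ω : V) : radialSymbol e F (fun ω => η (s⁻¹ • ω)) ω =
      ((s ^ (2 * e) : ℝ) : ℂ) * localizedSymbol e F η s (s⁻¹ • ω) := by
  have hn : ‖s⁻¹ • ω‖ = s⁻¹ * ‖ω‖ := by rw [norm_smul, Real.norm_of_nonneg (by positivity)]
  have h1 : s * (s⁻¹ * ‖ω‖) = ‖ω‖ := by field_simp
  have h2 : s ^ (2 * e) * (s⁻¹ ^ 2 + (s⁻¹ * ‖ω‖) ^ 2) ^ e = (1 + ‖ω‖ ^ 2) ^ e := by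
    rw [Real.rpow_mul hs.le, ← Real.mul_rpow (by positivity) (by positivity)]
    congr 1
    rw [Real.rpow_two]
    field_simp
  simp only [radialSymbol, localizedSymbol, hn, h1, Complex.real_smul]
  rw [← h2]
  push_cast
  ring

theorem exists_tsum_dyadic_rpow_le {a : ℝ} (ha : a < 0) : ∃ c : ℝ≥0∞, c ≠ ∞ ∧
    ∀ σ : ℝ, 0 < σ → ∑' n : ℕ, ENNReal.ofReal ((2 ^ n * σ) ^ a) = c * ENNReal.ofReal (σ ^ a) := by
  have h2 : ENNReal.ofReal ((2 : ℝ) ^ a) < 1 := by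
    rw [ENNReal.ofReal_lt_one]
    exact Real.rpow_lt_one_of_one_lt_of_neg one_lt_two ha
  refine ⟨(1 - ENNReal.ofReal ((2 : ℝ) ^ a))⁻¹, ?_, fun σ hσ => ?_⟩
  · rw [ENNReal.inv_ne_top]
    exact (tsub_pos_of_lt h2).ne'
  · rw [← ENNReal.tsum_geometric, ← ENNReal.tsum_mul_right]
    refine tsum_congr fun n => ?_
    rw [Real.mul_rpow (by positivity) hσ.le, ENNReal.ofReal_mul (by positivity),
      ← ENNReal.ofReal_pow (by positivity), ← Real.rpow_natCast, ← Real.rpow_natCast,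
      ← Real.rpow_mul zero_le_two, ← Real.rpow_mul zero_le_two, mul_comm a]

variable [FiniteDimensional ℝ V] [MeasurableSpace V] [BorelSpace V]

theorem fourier_comp_inv_smul (f : V → ℂ) {s : ℝ} (hs : 0 < s) (x : V) :
    𝓕 (fun ω => f (s⁻¹ • ω)) x = ((s ^ Module.finrank ℝ V : ℝ) : ℂ) * 𝓕 f (s • x) := by
  rw [Real.fourier_eq, Real.fourier_eq]
  have h := Measure.integral_comp_inv_smul_of_nonneg (volume : Measure V)
    (fun ω => Real.fourierChar (-inner ℝ ω (s • x)) • f ω) hs.le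
  rw [Complex.real_smul] at h
  rw [← h]
  refine integral_congr_ae (Filter.Eventually.of_forall fun ω => ?_)
  have : inner ℝ (s⁻¹ • ω) (s • x) = inner ℝ ω x := by
    rw [real_inner_smul_left, real_inner_smul_right, ← mul_assoc, inv_mul_cancel₀ hs.ne', one_mul]
  simp only [this]

theorem lintegral_comp_smul_of_pos {f : V → ℝ≥0∞} (hf : Measurable f) {s : ℝ} (hs : 0 < s) :
    ENNReal.ofReal (s ^ Module.finrank ℝ V) * ∫⁻ x, f (s • x) = ∫⁻ x, f x := by
  have hd : 0 < s ^ Module.finrank ℝ V := by positivity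
  rw [← lintegral_map hf (measurable_const_smul s), Measure.map_addHaar_smul volume hs.ne',
    lintegral_smul_measure, smul_eq_mul, ← mul_assoc, ← ENNReal.ofReal_mul hd.le,
    abs_of_pos (by positivity), mul_inv_cancel₀ hd.ne', ENNReal.ofReal_one, one_mul]

section Bounds

variable {e : ℝ} {F : ℝ → ℝ} {M : ℕ} {η : V → ℂ}

/-- Uniform bounds for the Fourier transforms of the localized symbols. -/
theorem exists_fourier_localizedSymbol_le {C : ℝ} (hM : Module.finrank ℝ V < 2 * M)
    (hη : ContDiff ℝ M η) (hη0 : ∀ ω ∉ unitAnnulus V, η ω = 0)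
    (hF : ContDiffOn ℝ M F (Set.Ici (1 / 2)))
    (hFB : ∀ s, 1 < s → ∀ n ≤ M, ∀ x : ℝ, 1 / 2 ≤ x →
      |iteratedDerivWithin n (fun x => F (s * x)) (Set.Ici (1 / 2)) x| ≤ C) {δ : ℝ} (hδ : 0 < δ) :
    ∃ B : ℝ≥0∞, B ≠ ∞ ∧ ∀ s, 1 < s → Continuous (localizedSymbol e F η s) ∧
      ∫⁻ x, ‖localizedSymbol e F η s x‖ₑ ≤ B ∧
      ∫⁻ x, ‖𝓕 (localizedSymbol e F η s) x‖ₑ ≤ B ∧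
      ∀ (N : ℕ) (z : Fin N → V), (∀ i j, i ≠ j → δ ≤ dist (z i) (z j)) → ∀ y,
        ∑ j, ‖𝓕 (localizedSymbol e F η s) (y - z j)‖ₑ ≤ B := by
  obtain ⟨B, hB⟩ := exists_norm_iteratedFDeriv_localizedSymbol_le e hη hη0 hF hFB
  obtain ⟨C₁, hC₁, h1⟩ := exists_lintegral_fourier_le (V := V) hM 2
  obtain ⟨C₂, hC₂, h2⟩ := exists_sum_fourier_le (V := V) 2 hδ
  set B₀ : ℝ≥0∞ := ENNReal.ofReal B * volume (Metric.closedBall (0 : V) 2)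
  set B₁ : ℝ≥0∞ := C₁ * ENNReal.ofReal B
  have hB₀ : B₀ ≠ ∞ := ENNReal.mul_ne_top ENNReal.ofReal_ne_top measure_closedBall_lt_top.ne
  have hB₁ : B₁ ≠ ∞ := ENNReal.mul_ne_top hC₁ ENNReal.ofReal_ne_top
  refine ⟨B₀ + B₁ + C₂ * B₁, ENNReal.add_ne_top.2 ⟨ENNReal.add_ne_top.2 ⟨hB₀, hB₁⟩,
    ENNReal.mul_ne_top hC₂ hB₁⟩, fun s hs => ?_⟩
  obtain ⟨hd, hb⟩ := hB s hs
  set W := localizedSymbol e F η s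
  have hW0 : ∀ x ∉ Metric.closedBall (0 : V) 2, W x = 0 := fun x hx =>
    localizedSymbol_eq_zero hη0 s fun h => hx (by simpa using h.2)
  have hWi : Integrable W := hd.continuous.integrable_of_hasCompactSupport
    (HasCompactSupport.intro (isCompact_closedBall (0 : V) 2) hW0)
  have hF1 : ∫⁻ x, ‖𝓕 W x‖ₑ ≤ B₁ := h1 W B hd hW0 hb
  have hFi : Integrable (𝓕 W) :=
    ⟨(continuous_fourier_of_integrable hWi).aestronglyMeasurable, hF1.trans_lt hB₁.lt_top⟩
  refine ⟨hd.continuous, ?_, ?_, fun N z hz y => ?_⟩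
  · refine le_trans ?_ (le_self_add.trans le_self_add)
    simp only [B₀]
    rw [← setLIntegral_const, ← lintegral_indicator Metric.isClosed_closedBall.measurableSet]
    refine lintegral_mono fun x => ?_
    by_cases hx : x ∈ Metric.closedBall (0 : V) 2
    · rw [Set.indicator_of_mem hx, ← ofReal_norm]
      exact ENNReal.ofReal_le_ofReal (by simpa using hb 0 (Nat.zero_le _) x)
    · simp only [hW0 x hx, enorm_zero, zero_le]
  · exact hF1.trans (le_add_self.trans le_self_add)
  · exact ((h2 W hd.continuous hW0 hFi N z hz y).trans (mul_le_mul_right hF1 _)).trans le_add_self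

/-- Bounds for the dyadic pieces, obtained by scaling from those for the localized symbols. -/
theorem fourier_radialSymbol_le_of_localizedSymbol {s δ : ℝ} (hs : 0 < s) {B : ℝ≥0∞}
    (hc : Continuous (localizedSymbol e F η s)) (h0 : ∫⁻ x, ‖localizedSymbol e F η s x‖ₑ ≤ B)
    (hB : B ≠ ∞) (h1 : ∫⁻ x, ‖𝓕 (localizedSymbol e F η s) x‖ₑ ≤ B)
    (h2 : ∀ (N : ℕ) (z : Fin N → V), (∀ i j, i ≠ j → δ ≤ dist (z i) (z j)) → ∀ y,
        ∑ j, ‖𝓕 (localizedSymbol e F η s) (y - z j)‖ₑ ≤ B) :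
    Continuous (radialSymbol e F (fun ω => η (s⁻¹ • ω))) ∧
      ∫⁻ x, ‖radialSymbol e F (fun ω => η (s⁻¹ • ω)) x‖ₑ ≤
        B * ENNReal.ofReal (s ^ (2 * e + Module.finrank ℝ V)) ∧
      ∫⁻ x, ‖𝓕 (radialSymbol e F (fun ω => η (s⁻¹ • ω))) x‖ₑ ≤
        B * ENNReal.ofReal (s ^ (2 * e)) ∧
      ∀ (N : ℕ) (z : Fin N → V), (∀ i j, i ≠ j → δ / s ≤ dist (z i) (z j)) → ∀ y,
        ∑ j, ‖𝓕 (radialSymbol e F (fun ω => η (s⁻¹ • ω))) (y - z j)‖ₑ ≤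
          B * ENNReal.ofReal (s ^ (2 * e + Module.finrank ℝ V)) := by
  set W := localizedSymbol e F η s
  set d := Module.finrank ℝ V
  have hQ : radialSymbol e F (fun ω => η (s⁻¹ • ω)) =
      fun ω => ((s ^ (2 * e) : ℝ) : ℂ) * W (s⁻¹ • ω) :=
    funext fun ω => radialSymbol_eq_localizedSymbol e F η hs ω
  have hp : s ^ (2 * e + d) = s ^ (2 * e) * s ^ d := by
    rw [Real.rpow_add hs, Real.rpow_natCast]
  have hWi : Integrable W := ⟨hc.aestronglyMeasurable, h0.trans_lt hB.lt_top⟩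
  -- The factor `s^d` produced by dilation is absorbed by the change of variables in the `L¹` norm
  -- but survives in the pointwise sums; hence the two different powers of `s`.
  have hFQ : ∀ x, 𝓕 (radialSymbol e F (fun ω => η (s⁻¹ • ω))) x =
      ((s ^ (2 * e + d) : ℝ) : ℂ) * 𝓕 W (s • x) := fun x => by
    have h := fourier_comp_inv_smul (fun ω => ((s ^ (2 * e) : ℝ) : ℂ) * W ω) hs x
    rw [hQ, h, Real.fourier_eq, Real.fourier_eq, hp]
    simp only [Circle.smul_def, smul_eq_mul, mul_left_comm _ ((s ^ (2 * e) : ℝ) : ℂ)]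
    rw [integral_const_mul]
    push_cast
    ring
  have he : ∀ r : ℝ, ‖((s ^ r : ℝ) : ℂ)‖ₑ = ENNReal.ofReal (s ^ r) := fun r => by
    rw [← ofReal_norm, Complex.norm_real, Real.norm_of_nonneg (by positivity)]
  have hWc := continuous_fourier_of_integrable hWi
  have hp' : ENNReal.ofReal (s ^ (2 * e + d)) =
      ENNReal.ofReal (s ^ (2 * e)) * ENNReal.ofReal (s ^ d) := by
    rw [hp, ENNReal.ofReal_mul (by positivity)]
  refine ⟨?_, ?_, ?_, fun N z hz y => ?_⟩
  · rw [hQ]; fun_prop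
  · rw [hQ]
    simp only [enorm_mul, he]
    have hm : Measurable fun x => ‖W (s⁻¹ • x)‖ₑ :=
      (hc.comp (continuous_const_smul s⁻¹)).enorm.measurable
    rw [lintegral_const_mul _ hm, hp']
    have h := lintegral_comp_smul_of_pos hm hs
    simp only [smul_smul, inv_mul_cancel₀ hs.ne', one_smul] at h
    rw [← h, mul_comm B, mul_assoc]
    gcongr
  · simp only [hFQ, enorm_mul, he]
    have hm : Measurable fun x => ‖𝓕 W (s • x)‖ₑ :=
      (hWc.comp (continuous_const_smul s)).enorm.measurable
    rw [lintegral_const_mul _ hm, hp', mul_assoc,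
      lintegral_comp_smul_of_pos (f := fun x => ‖𝓕 W x‖ₑ) (by fun_prop) hs, mul_comm B]
    gcongr
  · simp only [hFQ, enorm_mul, he, smul_sub]
    rw [← Finset.mul_sum, mul_comm B]
    refine mul_le_mul_right (h2 N (fun j => s • z j) (fun i j hij => ?_) (s • y)) _
    have := hz i j hij
    rw [div_le_iff₀ hs] at this
    rw [dist_smul₀, Real.norm_of_nonneg hs.le]
    linarith

omit [FiniteDimensional ℝ V] [MeasurableSpace V] [BorelSpace V] in
theorem hasSum_radialSymbol_dyadicDiff {κ : V → ℂ} (h1 : ∀ ω, ‖ω‖ ≤ 1 / 2 → κ ω = 1) {σ : ℝ}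
    (hσ : 0 < σ) (ω : V) :
    HasSum (fun n : ℕ => radialSymbol e F (fun ω => dyadicDiff κ ((2 ^ n * σ)⁻¹ • ω)) ω)
      (radialSymbol e F (fun ω => 1 - κ (σ⁻¹ • ω)) ω) :=
  ((hasSum_dyadicDiff h1 hσ ω).const_smul _).const_smul _

/-- The Fourier transform of the high-frequency part of a symbol of order `2 e < -d`: bounds for its
integral and for its sums over separated points. -/
theorem exists_fourier_radialSymbol_le {C : ℝ} (hM : Module.finrank ℝ V < 2 * M)
    (he : 2 * e + Module.finrank ℝ V < 0) {κ : V → ℂ} (hκ : ContDiff ℝ M κ)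
    (hκ1 : ∀ ω, ‖ω‖ ≤ 1 / 2 → κ ω = 1) (hκ0 : ∀ ω, 1 ≤ ‖ω‖ → κ ω = 0)
    (hF : ContDiffOn ℝ M F (Set.Ici (1 / 2)))
    (hFB : ∀ s, 1 < s → ∀ n ≤ M, ∀ x : ℝ, 1 / 2 ≤ x →
      |iteratedDerivWithin n (fun x => F (s * x)) (Set.Ici (1 / 2)) x| ≤ C) {δ : ℝ} (hδ : 0 < δ) :
    ∃ B : ℝ≥0∞, B ≠ ∞ ∧ ∀ σ, 1 < σ →
      Integrable (radialSymbol e F (fun ω => 1 - κ (σ⁻¹ • ω))) ∧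
      ∫⁻ x, ‖𝓕 (radialSymbol e F (fun ω => 1 - κ (σ⁻¹ • ω))) x‖ₑ ≤
        B * ENNReal.ofReal (σ ^ (2 * e)) ∧
      ∀ (N : ℕ) (z : Fin N → V), (∀ i j, i ≠ j → δ / σ ≤ dist (z i) (z j)) → ∀ y,
        ∑ j, ‖𝓕 (radialSymbol e F (fun ω => 1 - κ (σ⁻¹ • ω))) (y - z j)‖ₑ ≤
          B * ENNReal.ofReal (σ ^ (2 * e + Module.finrank ℝ V)) := by
  have hη : ContDiff ℝ M (dyadicDiff κ) :=
    (hκ.comp (contDiff_const_smul (2⁻¹ : ℝ))).sub hκ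
  obtain ⟨B, hBt, hB⟩ := exists_fourier_localizedSymbol_le (e := e) hM hη
    (fun ω hω => dyadicDiff_eq_zero hκ1 hκ0 hω) hF hFB hδ
  have he2 : 2 * e < 0 := by
    have : (0 : ℝ) ≤ Module.finrank ℝ V := Nat.cast_nonneg _
    linarith
  obtain ⟨c₁, hc₁, hs₁⟩ := exists_tsum_dyadic_rpow_le he2
  obtain ⟨c₂, hc₂, hs₂⟩ := exists_tsum_dyadic_rpow_le he
  refine ⟨B * c₁ + B * c₂, ENNReal.add_ne_top.2 ⟨ENNReal.mul_ne_top hBt hc₁,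
    ENNReal.mul_ne_top hBt hc₂⟩, fun σ hσ => ?_⟩
  have hσ0 : 0 < σ := one_pos.trans hσ
  have h2n : ∀ n : ℕ, (1 : ℝ) ≤ 2 ^ n := fun n => one_le_pow₀ one_le_two
  have hsn : ∀ n : ℕ, 1 < 2 ^ n * σ := fun n => by nlinarith [h2n n]
  let Q : ℕ → V → ℂ := fun n => radialSymbol e F (fun ω => dyadicDiff κ ((2 ^ n * σ)⁻¹ • ω))
  set H := radialSymbol e F (fun ω : V => 1 - κ (σ⁻¹ • ω))
  have hQ := fun n => fourier_radialSymbol_le_of_localizedSymbol (one_pos.trans (hsn n))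
    (hB _ (hsn n)).1 (hB _ (hsn n)).2.1 hBt (hB _ (hsn n)).2.2.1 (hB _ (hsn n)).2.2.2
  have hsum : ∀ ω, HasSum (fun n => Q n ω) (H ω) := hasSum_radialSymbol_dyadicDiff hκ1 hσ0
  -- Summability of the `L¹` norms of the pieces, from `2e + d < 0`, makes `H` integrable and lets
  -- the Fourier transform act term by term.
  have hQe : ∑' n, ∫⁻ x, ‖Q n x‖ₑ < ∞ := by
    refine (ENNReal.tsum_le_tsum fun n => (hQ n).2.1).trans_lt ?_
    rw [ENNReal.tsum_mul_left, hs₂ σ hσ0]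
    exact ENNReal.mul_lt_top hBt.lt_top (ENNReal.mul_lt_top hc₂.lt_top ENNReal.ofReal_lt_top)
  have hQi : ∀ n, Integrable (Q n) := fun n =>
    ⟨(hQ n).1.aestronglyMeasurable, (ENNReal.le_tsum n).trans_lt hQe⟩
  have henorm : ∀ {f : ℕ → ℂ} {a : ℂ}, HasSum f a → ‖a‖ₑ ≤ ∑' n, ‖f n‖ₑ := fun {f a} h => by
    refine le_of_tendsto' ((continuous_enorm.tendsto a).comp h) fun s => ?_
    exact (enorm_sum_le _ _).trans (ENNReal.sum_le_tsum s)
  have hHm : AEStronglyMeasurable H volume := by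
    refine aestronglyMeasurable_of_tendsto_ae Filter.atTop
      (f := fun n x => ∑ i ∈ Finset.range n, Q i x) (fun n => ?_)
      (Filter.Eventually.of_forall fun x => (hsum x).tendsto_sum_nat)
    exact (continuous_finsetSum _ fun i _ => (hQ i).1).aestronglyMeasurable
  have hHi : Integrable H := by
    refine ⟨hHm, lt_of_le_of_lt ?_ hQe⟩
    rw [← lintegral_tsum fun n => ((hQ n).1.enorm).aemeasurable]
    exact lintegral_mono fun x => henorm (hsum x)
  have hFsum : ∀ x, HasSum (fun n => 𝓕 (Q n) x) (𝓕 H x) := fun x => by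
    have h := hasSum_integral_of_summable_integral_norm
      (F := fun n ω => Real.fourierChar (-inner ℝ ω x) • Q n ω)
      (fun n => (Real.fourierIntegral_convergent_iff x).2 (hQi n)) ?_
    · simp only [Real.fourier_eq]
      convert! h using 1
      exact integral_congr_ae (Filter.Eventually.of_forall fun ω =>
        ((hsum ω).const_smul _).tsum_eq.symm)
    · simp only [Circle.norm_smul]
      have := ENNReal.summable_toReal hQe.ne
      refine this.congr fun n => ?_
      rw [integral_norm_eq_lintegral_enorm (hQi n).1]
  refine ⟨hHi, ?_, fun N z hz y => ?_⟩
  · calc ∫⁻ x, ‖𝓕 H x‖ₑ ≤ ∫⁻ x, ∑' n, ‖𝓕 (Q n) x‖ₑ :=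
          lintegral_mono fun x => henorm (hFsum x)
      _ = ∑' n, ∫⁻ x, ‖𝓕 (Q n) x‖ₑ := lintegral_tsum fun n =>
          ((continuous_fourier_of_integrable (hQi n)).enorm).aemeasurable
      _ ≤ ∑' n : ℕ, B * ENNReal.ofReal ((2 ^ n * σ) ^ (2 * e)) :=
          ENNReal.tsum_le_tsum fun n => (hQ n).2.2.1
      _ = B * c₁ * ENNReal.ofReal (σ ^ (2 * e)) := by
          rw [ENNReal.tsum_mul_left, hs₁ σ hσ0, mul_assoc]
      _ ≤ _ := mul_le_mul_left le_self_add _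
  · calc ∑ j, ‖𝓕 H (y - z j)‖ₑ ≤ ∑ j, ∑' n, ‖𝓕 (Q n) (y - z j)‖ₑ :=
          Finset.sum_le_sum fun j _ => henorm (hFsum _)
      _ = ∑' n, ∑ j, ‖𝓕 (Q n) (y - z j)‖ₑ :=
          (Summable.tsum_finsetSum fun _ _ => ENNReal.summable).symm
      _ ≤ ∑' n : ℕ, B * ENNReal.ofReal ((2 ^ n * σ) ^ (2 * e + Module.finrank ℝ V)) := by
          -- Points that are `δ/σ`-separated are also `δ/(2ⁿσ)`-separated, as the scale `2ⁿσ`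
          -- requires.
          refine ENNReal.tsum_le_tsum fun n => (hQ n).2.2.2 N z (fun i j hij => ?_) y
          refine le_trans ?_ (hz i j hij)
          gcongr
          nlinarith [h2n n]
      _ = B * c₂ * ENNReal.ofReal (σ ^ (2 * e + Module.finrank ℝ V)) := by
          rw [ENNReal.tsum_mul_left, hs₂ σ hσ0, mul_assoc]
      _ ≤ _ := mul_le_mul_left le_add_self _

end Bounds

end DyadicSum

/-! ### Young's inequality for finite sums of translates -/

section DiscreteYoung

theorem ofReal_norm_toLp_eq {N : ℕ} (a : Fin N → ℝ) {p : ℝ≥0∞} (hp : 1 ≤ p) (hpt : p ≠ ∞) :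
    ENNReal.ofReal ‖(WithLp.toLp p a : PiLp p (fun _ : Fin N => ℝ))‖ =
      (∑ j, ‖a j‖ₑ ^ p.toReal) ^ p.toReal⁻¹ := by
  have hp0 : 0 < p.toReal := ENNReal.toReal_pos (one_pos.trans_le hp).ne' hpt
  rw [PiLp.norm_eq_sum hp0, ← ENNReal.ofReal_rpow_of_nonneg (Finset.sum_nonneg fun _ _ => by
    positivity) (by positivity), ENNReal.ofReal_sum_of_nonneg (fun _ _ => by positivity), one_div]
  congr 1
  refine Finset.sum_congr rfl fun j _ => ?_
  rw [← ENNReal.ofReal_rpow_of_nonneg (norm_nonneg _) hp0.le, ofReal_norm]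

/-- Young's inequality for a discrete measure and a function `h`, in terms of the integral of `h`
and of its sums over the translates. -/
theorem eLpNorm_sum_mul_translate_le {V : Type*} [NormedAddCommGroup V] [MeasureSpace V]
    [BorelSpace V] [(volume : Measure V).IsAddRightInvariant] {h : V → ℂ} (hc : Continuous h)
    {N : ℕ} (a : Fin N → ℝ) (ξ : Fin N → V) {A S : ℝ≥0∞} (hA : ∫⁻ x, ‖h x‖ₑ ≤ A)
    (hS : ∀ x, ∑ j, ‖h (x - ξ j)‖ₑ ≤ S) {p p' : ℝ≥0∞} (hp : 1 ≤ p) (hpp : p⁻¹ + p'⁻¹ = 1) :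
    eLpNorm (fun x => ∑ j, (a j : ℂ) * h (x - ξ j)) p ≤
      A ^ (p⁻¹).toReal * S ^ (p'⁻¹).toReal *
        ENNReal.ofReal ‖(WithLp.toLp p a : PiLp p (fun _ : Fin N => ℝ))‖ := by
  have hae : ∀ j, ‖(a j : ℂ)‖ₑ = ‖a j‖ₑ := fun j => by
    rw [← ofReal_norm, ← ofReal_norm, Complex.norm_real]
  have hu : ∀ x, ‖∑ j, (a j : ℂ) * h (x - ξ j)‖ₑ ≤ ∑ j, ‖h (x - ξ j)‖ₑ * ‖a j‖ₑ := fun x => by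
    refine (enorm_sum_le _ _).trans (le_of_eq (Finset.sum_congr rfl fun j _ => ?_))
    rw [enorm_mul, hae, mul_comm]
  by_cases hpt : p = ∞
  · subst hpt
    have hp' : p'⁻¹ = 1 := by simpa using hpp
    rw [hp', ENNReal.inv_top, ENNReal.toReal_zero, ENNReal.rpow_zero, one_mul, ENNReal.toReal_one,
      ENNReal.rpow_one, eLpNorm_exponent_top]
    refine eLpNormEssSup_le_of_ae_enorm_bound (Filter.Eventually.of_forall fun x => ?_)
    refine (hu x).trans (le_trans (Finset.sum_le_sum (g := fun j => ‖h (x - ξ j)‖ₑ *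
      ENNReal.ofReal ‖(WithLp.toLp ∞ a : PiLp ∞ (fun _ : Fin N => ℝ))‖)
      fun j _ => mul_le_mul_right ?_ _) ?_)
    · rw [← ofReal_norm]
      exact ENNReal.ofReal_le_ofReal
        (PiLp.norm_apply_le (WithLp.toLp ∞ a : PiLp ∞ (fun _ : Fin N => ℝ)) j)
    · rw [← Finset.sum_mul]
      exact mul_le_mul_left (hS x) _
  · have hp0 : p ≠ 0 := (one_pos.trans_le hp).ne'
    set r := p.toReal with hr
    have hr1 : 1 ≤ r := by
      have := ENNReal.toReal_mono hpt hp
      simpa using this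
    have hr0 : 0 < r := by linarith
    have hq : (p'⁻¹).toReal = 1 - r⁻¹ := by
      have hne : p⁻¹ ≠ ∞ := ENNReal.inv_ne_top.2 hp0
      have hne' : p'⁻¹ ≠ ∞ := fun h => by rw [h] at hpp; simp at hpp
      have := congrArg ENNReal.toReal hpp
      rw [ENNReal.toReal_add hne hne', ENNReal.toReal_inv, ENNReal.toReal_one] at this
      linarith
    rw [ofReal_norm_toLp_eq a hp hpt, hq, ENNReal.toReal_inv,
      eLpNorm_eq_lintegral_rpow_enorm_toReal hp0 hpt, one_div, ← hr]
    -- Hölder's inequality with the values `|h(x - ξⱼ)|` as weights: the total weight is at most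
    -- `S`, and the remaining sum is linear in the weights, so its integral involves only `A`.
    have hpt' : ∀ x, ‖∑ j, (a j : ℂ) * h (x - ξ j)‖ₑ ^ r ≤
        (S ^ (1 - r⁻¹)) ^ r * ∑ j, ‖h (x - ξ j)‖ₑ * ‖a j‖ₑ ^ r := fun x => by
      have h1 := ENNReal.inner_le_weight_mul_Lp_of_nonneg Finset.univ hr1
        (fun j => ‖h (x - ξ j)‖ₑ) (fun j => ‖a j‖ₑ)
      have h2 := ENNReal.rpow_le_rpow ((hu x).trans h1) hr0.le
      rw [ENNReal.mul_rpow_of_nonneg _ _ hr0.le, ENNReal.rpow_inv_rpow hr0.ne'] at h2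
      refine h2.trans (mul_le_mul_left ?_ _)
      refine ENNReal.rpow_le_rpow (ENNReal.rpow_le_rpow (hS x) ?_) hr0.le
      have := inv_le_one_of_one_le₀ hr1
      linarith
    have hm : ∀ j, Measurable fun x => ‖h (x - ξ j)‖ₑ := fun j =>
      (hc.comp (continuous_id.sub continuous_const)).enorm.measurable
    have hint : ∫⁻ x, ‖∑ j, (a j : ℂ) * h (x - ξ j)‖ₑ ^ r ≤
        (S ^ (1 - r⁻¹)) ^ r * (A * ∑ j, ‖a j‖ₑ ^ r) := by
      refine (lintegral_mono hpt').trans ?_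
      rw [lintegral_const_mul _ (Finset.measurable_fun_sum _ fun j _ => (hm j).mul_const _),
        lintegral_finsetSum _ fun j _ => (hm j).mul_const _]
      refine mul_le_mul_right ?_ _
      rw [Finset.mul_sum]
      refine Finset.sum_le_sum fun j _ => ?_
      rw [lintegral_mul_const _ (hm j), lintegral_sub_right_eq_self (fun x => ‖h x‖ₑ)]
      exact mul_le_mul_left hA _
    refine (ENNReal.rpow_le_rpow hint (by positivity)).trans (le_of_eq ?_)
    rw [ENNReal.mul_rpow_of_nonneg _ _ (by positivity), ENNReal.rpow_rpow_inv hr0.ne',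
      ENNReal.mul_rpow_of_nonneg _ _ (by positivity)]
    ring

end DiscreteYoung

/-! ### The symmetric normalization of the Fourier transform -/

section FourierHat

open FourierTransform

variable {d : ℕ}

/-- The constant `(2π)^(-d/2)` of the symmetric normalization. -/
def hatConst (d : ℕ) : ℝ := (2 * Real.pi) ^ (-(d : ℝ) / 2)

theorem hatConst_pos (d : ℕ) : 0 < hatConst d := by
  unfold hatConst
  positivity

theorem hatConst_mul_self_mul (d : ℕ) :
    ((2 * Real.pi) ^ d : ℝ) * (hatConst d * hatConst d) = 1 := by
  unfold hatConst
  rw [← Real.rpow_add (by positivity), ← Real.rpow_natCast, ← Real.rpow_add (by positivity)]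
  rw [show (d : ℝ) + (-(d : ℝ) / 2 + -(d : ℝ) / 2) = 0 by ring, Real.rpow_zero]

theorem fourierHat_eq (f : EuclideanSpace ℝ (Fin d) → ℂ) (ω : EuclideanSpace ℝ (Fin d)) :
    fourierHat f ω = (hatConst d : ℂ) * 𝓕 f ((2 * Real.pi)⁻¹ • ω) := by
  rw [fourierHat, Real.fourier_eq']
  congr 1
  refine integral_congr_ae (Filter.Eventually.of_forall fun x => ?_)
  simp only [smul_eq_mul]
  rw [mul_comm, real_inner_smul_right, real_inner_comm]
  congr 3
  have := Real.pi_pos.ne'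
  push_cast
  field_simp

theorem continuous_fourierHat {f : EuclideanSpace ℝ (Fin d) → ℂ} (hf : Integrable f) :
    Continuous (fourierHat f) := by
  have h : fourierHat f = fun ω => (hatConst d : ℂ) * 𝓕 f ((2 * Real.pi)⁻¹ • ω) :=
    funext (fourierHat_eq f)
  rw [h]
  exact continuous_const.mul ((continuous_fourier_of_integrable hf).comp (continuous_const_smul _))

theorem fourierHat_sub {f g : EuclideanSpace ℝ (Fin d) → ℂ} (hf : Integrable f)
    (hg : Integrable g) (ω : EuclideanSpace ℝ (Fin d)) :
    fourierHat (fun x => f x - g x) ω = fourierHat f ω - fourierHat g ω := by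
  simp only [fourierHat_eq, Real.fourier_eq, smul_sub]
  rw [integral_sub ((Real.fourierIntegral_convergent_iff _).2 hf)
    ((Real.fourierIntegral_convergent_iff _).2 hg), mul_sub]

theorem integral_fourierHat_mul {f g : EuclideanSpace ℝ (Fin d) → ℂ} (hf : Integrable f)
    (hg : Integrable g) : ∫ x, fourierHat f x * g x = ∫ x, f x * fourierHat g x := by
  have hτ : (0 : ℝ) < 2 * Real.pi := by positivity
  simp only [fourierHat_eq, mul_assoc, mul_left_comm _ (hatConst d : ℂ)]
  rw [integral_const_mul, integral_const_mul]
  congr 1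
  have h2 := Measure.integral_comp_inv_smul_of_nonneg
    (volume : Measure (EuclideanSpace ℝ (Fin d)))
    (fun x => 𝓕 f x * g ((2 * Real.pi) • x)) hτ.le
  simp only [smul_smul, mul_inv_cancel₀ hτ.ne', one_smul, finrank_euclideanSpace_fin] at h2
  have hg' : Integrable (fun x => g ((2 * Real.pi) • x)) := hg.comp_smul hτ.ne'
  rw [h2, integral_fourier_mul_eq_mul_fourier hf hg', Complex.real_smul, ← integral_const_mul]
  refine integral_congr_ae (Filter.Eventually.of_forall fun x => ?_)
  have h3 := fourier_comp_inv_smul (fun x => g ((2 * Real.pi) • x)) hτ ((2 * Real.pi)⁻¹ • x)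
  simp only [smul_smul, mul_inv_cancel₀ hτ.ne', one_smul, finrank_euclideanSpace_fin] at h3
  simp only
  rw [h3]
  ring

/-- Inversion in the symmetric normalization: the Jacobian `(2π)^d` of the rescaling cancels the two
constants `(2π)^(-d/2)`. -/
theorem fourierHat_fourierHat (θ : 𝓢(EuclideanSpace ℝ (Fin d), ℂ))
    (ω : EuclideanSpace ℝ (Fin d)) :
    fourierHat (fun x => fourierHat (fun y => θ y) x) ω = θ (-ω) := by
  have hτ : (0 : ℝ) < 2 * Real.pi := by positivity
  have h1 : 𝓕 (fun x => fourierHat (fun y => θ y) x) ((2 * Real.pi)⁻¹ • ω) =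
      (hatConst d : ℂ) * 𝓕 (fun x => 𝓕 (fun y => θ y) ((2 * Real.pi)⁻¹ • x))
        ((2 * Real.pi)⁻¹ • ω) := by
    rw [Real.fourier_eq, Real.fourier_eq, ← integral_const_mul]
    refine integral_congr_ae (Filter.Eventually.of_forall fun x => ?_)
    simp only [fourierHat_eq, Circle.smul_def, smul_eq_mul]
    ring
  rw [fourierHat_eq, h1, fourier_comp_inv_smul _ hτ, smul_smul, mul_inv_cancel₀ hτ.ne', one_smul,
    finrank_euclideanSpace_fin]
  have h2 : 𝓕 (𝓕 fun y => θ y) ω = θ (-ω) := by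
    have h3 := θ.continuous.fourierInv_fourier_eq θ.integrable
      (by have := (𝓕 θ).integrable (μ := volume); rwa [SchwartzMap.fourier_coe] at this)
    rw [← neg_neg ω, ← Real.fourierInv_eq_fourier_neg, neg_neg]
    exact congrFun h3 (-ω)
  rw [h2, ← mul_assoc, ← mul_assoc]
  have h4 := hatConst_mul_self_mul d
  have h5 : (hatConst d : ℂ) * hatConst d * (((2 * Real.pi) ^ d : ℝ) : ℂ) = 1 := by
    rw [← Complex.ofReal_mul, ← Complex.ofReal_mul, mul_comm, h4, Complex.ofReal_one]
  rw [h5, one_mul]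

theorem fourierHat_modulate (f : EuclideanSpace ℝ (Fin d) → ℂ) (ξ x : EuclideanSpace ℝ (Fin d)) :
    fourierHat (fun ω => Complex.exp (-((inner ℝ ω ξ : ℝ) : ℂ) * Complex.I) * f ω) x =
      fourierHat f (x + ξ) := by
  unfold fourierHat
  congr 1
  refine integral_congr_ae (Filter.Eventually.of_forall fun ω => ?_)
  simp only [inner_add_left, Complex.ofReal_add, neg_add, add_mul, Complex.exp_add]
  rw [real_inner_comm]
  ring

theorem exists_norm_fourierHat_le (γ : 𝓢(EuclideanSpace ℝ (Fin d), ℂ)) (k : ℕ) :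
    ∃ c : ℝ, 0 ≤ c ∧ ∀ x, ‖fourierHat (fun y => γ y) x‖ ≤ c * ((1 + ‖x‖) ^ k)⁻¹ := by
  obtain ⟨c, hc0, hc⟩ := SchwartzMap.exists_norm_le_inv_one_add_norm_pow (𝓕 γ) k
  refine ⟨hatConst d * (c * (2 * Real.pi) ^ k), by have := hatConst_pos d; positivity,
    fun x => ?_⟩
  rw [fourierHat_eq, norm_mul, Complex.norm_real, Real.norm_of_nonneg (hatConst_pos d).le,
    mul_assoc]
  refine mul_le_mul_of_nonneg_left ?_ (hatConst_pos d).le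
  have h := hc ((2 * Real.pi)⁻¹ • x)
  rw [SchwartzMap.fourier_coe] at h
  refine h.trans ?_
  rw [mul_assoc]
  refine mul_le_mul_of_nonneg_left ?_ hc0
  rw [norm_smul, Real.norm_of_nonneg (by positivity), ← div_eq_mul_inv,
    inv_le_comm₀ (by positivity) (by positivity), inv_div, div_le_iff₀ (by positivity), ← mul_pow]
  refine pow_le_pow_left₀ (by positivity) ?_ k
  have hpi := Real.pi_gt_three
  rw [add_mul, mul_right_comm, inv_mul_cancel₀ (by positivity)]
  linarith

theorem integrable_fourierHat (γ : 𝓢(EuclideanSpace ℝ (Fin d), ℂ)) :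
    Integrable (fourierHat (fun y => γ y)) := by
  have hτ : (0 : ℝ) < 2 * Real.pi := by positivity
  have h : fourierHat (fun y => γ y) =
      fun ω => (hatConst d : ℂ) * (𝓕 γ) ((2 * Real.pi)⁻¹ • ω) := funext fun ω => by
    rw [fourierHat_eq, SchwartzMap.fourier_coe]
  rw [h]
  exact ((𝓕 γ).integrable.comp_smul (inv_ne_zero hτ.ne')).const_mul _

theorem convHat_eq_convolution (g K : EuclideanSpace ℝ (Fin d) → ℝ)
    (x : EuclideanSpace ℝ (Fin d)) :
    ((convHat g K x : ℝ) : ℂ) = (hatConst d : ℂ) *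
      convolution (fun x => (g x : ℂ)) (fun x => (K x : ℂ)) (ContinuousLinearMap.mul ℂ ℂ)
        volume x := by
  rw [convHat, convolution_def]
  simp only [ContinuousLinearMap.mul_apply', ← Complex.ofReal_mul]
  rw [integral_complex_ofReal, ← Complex.ofReal_mul]
  rfl

theorem integrable_convHat {g K : EuclideanSpace ℝ (Fin d) → ℝ} (hg : Integrable g)
    (hK : Integrable K) : Integrable (fun x => ((convHat g K x : ℝ) : ℂ)) := by
  simp only [convHat_eq_convolution]
  exact (hg.ofReal.integrable_convolution _ hK.ofReal).const_mul _

theorem fourierHat_convHat {g K : EuclideanSpace ℝ (Fin d) → ℝ} (hg : Integrable g)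
    (hK : Integrable K) (ω : EuclideanSpace ℝ (Fin d)) :
    fourierHat (fun x => ((convHat g K x : ℝ) : ℂ)) ω =
      fourierHat (fun x => (g x : ℂ)) ω * fourierHat (fun x => (K x : ℂ)) ω := by
  have h := Real.fourier_mul_convolution_eq (hg.ofReal (𝕜 := ℂ)) (hK.ofReal (𝕜 := ℂ))
    ((2 * Real.pi)⁻¹ • ω)
  simp only [convHat_eq_convolution, fourierHat_eq]
  have h2 : 𝓕 (fun x => (hatConst d : ℂ) *
      convolution (fun x => (g x : ℂ)) (fun x => (K x : ℂ)) (ContinuousLinearMap.mul ℂ ℂ)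
        volume x) ((2 * Real.pi)⁻¹ • ω) = (hatConst d : ℂ) *
      𝓕 (convolution (fun x => (g x : ℂ)) (fun x => (K x : ℂ)) (ContinuousLinearMap.mul ℂ ℂ)
        volume) ((2 * Real.pi)⁻¹ • ω) := by
    rw [Real.fourier_eq, Real.fourier_eq, ← integral_const_mul]
    refine integral_congr_ae (Filter.Eventually.of_forall fun x => ?_)
    simp only [Circle.smul_def, smul_eq_mul]
    ring
  rw [h2]
  erw [h]
  ring_nf
  rfl

theorem IsTemperedFun.integrable_mul {f : EuclideanSpace ℝ (Fin d) → ℂ} (hf : IsTemperedFun f)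
    {ρ : EuclideanSpace ℝ (Fin d) → ℂ} (hρ : Continuous ρ)
    (hb : ∀ k : ℕ, ∃ c : ℝ, 0 ≤ c ∧ ∀ x, ‖ρ x‖ ≤ c * ((1 + ‖x‖) ^ k)⁻¹) :
    Integrable (fun x => f x * ρ x) := by
  obtain ⟨N, hN⟩ := hf
  obtain ⟨c, hc0, hc⟩ := hb N
  have h := hN.mul_bdd (g := fun x => (((1 + ‖x‖) ^ N : ℝ) : ℂ) * ρ x) (c := c)
    (Continuous.aestronglyMeasurable (by fun_prop)) (Filter.Eventually.of_forall fun x => by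
      rw [norm_mul, Complex.norm_real, Real.norm_of_nonneg (by positivity), mul_comm,
        ← le_div_iff₀ (by positivity), div_eq_mul_inv]
      exact hc x)
  refine h.congr (Filter.Eventually.of_forall fun x => ?_)
  have h1 : (1 + ‖x‖) ^ (-(N : ℝ)) * (1 + ‖x‖) ^ N = 1 := by
    rw [← Real.rpow_natCast, ← Real.rpow_add (by positivity), neg_add_cancel, Real.rpow_zero]
  have h2 := congrArg (fun r : ℝ => (r : ℂ)) h1
  simp only [Complex.ofReal_mul, Complex.ofReal_one] at h2 ⊢
  calc _ = ((((1 + ‖x‖) ^ (-(N : ℝ)) : ℝ) : ℂ) * (((1 + ‖x‖) ^ N : ℝ) : ℂ)) * (f x * ρ x) := by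
        ring
    _ = _ := by rw [h2, one_mul]

theorem isTemperedFun_of_integrable {f : EuclideanSpace ℝ (Fin d) → ℂ} (hf : Integrable f) :
    IsTemperedFun f := ⟨0, by simpa using hf⟩

end FourierHat

/-! ### Fourier transform and Bessel representation of a network -/

section Network

open FourierTransform

variable {d N : ℕ}

/-- The exponential sum `∑ⱼ aⱼ exp(-i ω·ξⱼ)`. -/
def expSum (ξ : Fin N → EuclideanSpace ℝ (Fin d)) (a : Fin N → ℝ)
    (ω : EuclideanSpace ℝ (Fin d)) : ℂ :=
  ∑ j, (a j : ℂ) * Complex.exp (-((inner ℝ ω (ξ j) : ℝ) : ℂ) * Complex.I)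

theorem continuous_expSum (ξ : Fin N → EuclideanSpace ℝ (Fin d)) (a : Fin N → ℝ) :
    Continuous (expSum ξ a) := by
  unfold expSum
  fun_prop

/-- Translating `Φ` modulates the test function. Modulation does not enlarge the support, so the new
test function still avoids the origin and the defining identity of `φ` applies to it. -/
theorem HasRadialGenFourier.integral_translate {Φ : EuclideanSpace ℝ (Fin d) → ℝ} {φ : ℝ → ℝ}
    (h : HasRadialGenFourier Φ φ) {γ : 𝓢(EuclideanSpace ℝ (Fin d), ℂ)}
    (hγ : HasCompactSupport γ) (hγ0 : 0 ∉ tsupport γ) (ξ : EuclideanSpace ℝ (Fin d)) :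
    Integrable (fun x => (Φ (x - ξ) : ℂ) * fourierHat (fun ω => γ ω) x) ∧
      ∫ x, (Φ (x - ξ) : ℂ) * fourierHat (fun ω => γ ω) x =
        ∫ ω, (φ ‖ω‖ : ℂ) * (Complex.exp (-((inner ℝ ω ξ : ℝ) : ℂ) * Complex.I) * γ ω) := by
  set f : EuclideanSpace ℝ (Fin d) → ℂ :=
    fun ω => Complex.exp (-((inner ℝ ω ξ : ℝ) : ℂ) * Complex.I) * γ ω with hf
  have hfs : HasCompactSupport f := hγ.mul_left
  have hfd : ContDiff ℝ ((⊤ : ℕ∞) : WithTop ℕ∞) f := by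
    have h1 : ContDiff ℝ ((⊤ : ℕ∞) : WithTop ℕ∞)
        (fun ω : EuclideanSpace ℝ (Fin d) => ((inner ℝ ω ξ : ℝ) : ℂ)) :=
      Complex.ofRealCLM.contDiff.comp (contDiff_id.inner ℝ contDiff_const)
    exact ((h1.neg.mul contDiff_const).cexp).mul (γ.smooth _)
  have hf0 : 0 ∉ tsupport (hfs.toSchwartzMap hfd) := fun h0 =>
    hγ0 ((closure_mono fun x hx hγx => hx (by
      change f x = 0
      simp [hf, hγx]) : tsupport (hfs.toSchwartzMap hfd) ⊆ tsupport γ) h0)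
  have h1 := h.2.2 (hfs.toSchwartzMap hfd) hfs hf0
  have hhat : ∀ x, fourierHat (fun ω => hfs.toSchwartzMap hfd ω) x =
      fourierHat (fun ω => γ ω) (x + ξ) := fun x => fourierHat_modulate (fun ω => γ ω) ξ x
  have h2 : Integrable (fun x => (Φ x : ℂ) * fourierHat (fun ω => hfs.toSchwartzMap hfd ω) x) :=
    h.1.integrable_mul (continuous_fourierHat (SchwartzMap.integrable _))
      (exists_norm_fourierHat_le _)
  have hshift : (fun x => (Φ (x - ξ) : ℂ) * fourierHat (fun ω => γ ω) x) = fun x =>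
      (fun x => (Φ x : ℂ) * fourierHat (fun ω => hfs.toSchwartzMap hfd ω) x) (x - ξ) :=
    funext fun x => by simp only [hhat, sub_add_cancel]
  rw [hshift]
  refine ⟨h2.comp_sub_right ξ, ?_⟩
  rw [integral_sub_right_eq_self
    (fun x => (Φ x : ℂ) * fourierHat (fun ω => hfs.toSchwartzMap hfd ω) x) ξ, h1]
  rfl

/-- A single translate has only a generalized transform, but the integrable combination has a
continuous one. Both sides have equal pairings with test functions supported away from `0`, hence
agree a.e. there. -/
theorem fourierHat_rbfNetwork_ae_eq {Φ : EuclideanSpace ℝ (Fin d) → ℝ} {φ : ℝ → ℝ}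
    (h : HasRadialGenFourier Φ φ) (ξ : Fin N → EuclideanSpace ℝ (Fin d)) (a : Fin N → ℝ)
    (hg : Integrable (rbfNetwork Φ ξ a)) :
    ∀ᵐ ω, ω ∈ ({0}ᶜ : Set (EuclideanSpace ℝ (Fin d))) →
      fourierHat (fun x => (rbfNetwork Φ ξ a x : ℂ)) ω = φ ‖ω‖ * expSum ξ a ω := by
  have hgc : Continuous (fourierHat (fun x => (rbfNetwork Φ ξ a x : ℂ))) :=
    continuous_fourierHat hg.ofReal
  have hloc : LocallyIntegrableOn (fun ω => fourierHat (fun x => (rbfNetwork Φ ξ a x : ℂ)) ω -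
      φ ‖ω‖ • expSum ξ a ω) {0}ᶜ :=
    (hgc.locallyIntegrable.locallyIntegrableOn _).sub
      (h.2.1.smul_continuousOn isOpen_compl_singleton.isLocallyClosed
        (continuous_expSum ξ a).continuousOn)
  have key := isOpen_compl_singleton.ae_eq_zero_of_integral_contDiff_smul_eq_zero hloc ?_
  · filter_upwards [key] with ω hω h0
    have := hω h0
    rw [Complex.real_smul] at this
    exact sub_eq_zero.1 this
  intro g hgd hgs hg0
  have hgs' : HasCompactSupport (fun x => (g x : ℂ)) := hgs.comp_left Complex.ofReal_zero
  let γ : 𝓢(EuclideanSpace ℝ (Fin d), ℂ) :=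
    hgs'.toSchwartzMap (Complex.ofRealCLM.contDiff.comp hgd)
  have hγ : ∀ x, γ x = (g x : ℂ) := fun x => rfl
  have hγs : HasCompactSupport γ := hgs'
  have hγ0 : 0 ∉ tsupport γ := fun h0 => by
    have h1 : tsupport γ ⊆ tsupport g := closure_mono fun x hx hgx => hx (by simp [hγ, hgx])
    exact hg0 (h1 h0) rfl
  have hT := fun j => h.integral_translate hγs hγ0 (ξ j)
  have h1 : ∫ ω, g ω • fourierHat (fun x => (rbfNetwork Φ ξ a x : ℂ)) ω =
      ∑ j, (a j : ℂ) * ∫ ω, (φ ‖ω‖ : ℂ) *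
        (Complex.exp (-((inner ℝ ω (ξ j) : ℝ) : ℂ) * Complex.I) * γ ω) := by
    calc ∫ ω, g ω • fourierHat (fun x => (rbfNetwork Φ ξ a x : ℂ)) ω
        = ∫ ω, fourierHat (fun x => (rbfNetwork Φ ξ a x : ℂ)) ω * γ ω := by
          simp only [Complex.real_smul, hγ, mul_comm]
      _ = ∫ x, (rbfNetwork Φ ξ a x : ℂ) * fourierHat (fun ω => γ ω) x :=
          integral_fourierHat_mul hg.ofReal γ.integrable
      _ = ∫ x, ∑ j, (a j : ℂ) * ((Φ (x - ξ j) : ℂ) * fourierHat (fun ω => γ ω) x) := by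
          refine integral_congr_ae (Filter.Eventually.of_forall fun x => ?_)
          simp only [rbfNetwork, Complex.ofReal_sum, Complex.ofReal_mul, Finset.sum_mul, mul_assoc]
      _ = _ := by
          rw [integral_finsetSum _ fun j _ => (hT j).1.const_mul _]
          refine Finset.sum_congr rfl fun j _ => ?_
          rw [integral_const_mul, (hT j).2]
  have hφi : ∀ f : EuclideanSpace ℝ (Fin d) → ℂ, Continuous f →
      Integrable (fun ω => (φ ‖ω‖ : ℂ) * (f ω * γ ω)) := fun f hf => by
    have hK : IntegrableOn (fun ω => φ ‖ω‖ • (f ω * γ ω)) (tsupport g) :=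
      (h.2.1.smul_continuousOn isOpen_compl_singleton.isLocallyClosed
        (hf.mul γ.continuous).continuousOn).integrableOn_compact_subset hg0 hgs
    simp only [Complex.real_smul] at hK
    refine hK.integrable_of_forall_notMem_eq_zero fun x hx => ?_
    rw [hγ, image_eq_zero_of_notMem_tsupport hx]
    simp
  have h2 : ∫ ω, g ω • (φ ‖ω‖ • expSum ξ a ω) =
      ∑ j, (a j : ℂ) * ∫ ω, (φ ‖ω‖ : ℂ) *
        (Complex.exp (-((inner ℝ ω (ξ j) : ℝ) : ℂ) * Complex.I) * γ ω) := by
    simp only [← integral_const_mul]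
    rw [← integral_finsetSum _ fun j _ => (hφi _ (by fun_prop)).const_mul _]
    refine integral_congr_ae (Filter.Eventually.of_forall fun ω => ?_)
    simp only [expSum, Complex.real_smul, hγ, Finset.mul_sum]
    refine Finset.sum_congr rfl fun j _ => ?_
    ring
  simp only [smul_sub]
  rw [integral_sub, h1, h2, sub_self]
  · exact (hgd.continuous.smul hgc).integrable_of_hasCompactSupport hgs.smul_right
  · refine (hφi _ (continuous_expSum ξ a)).congr (Filter.Eventually.of_forall fun ω => ?_)
    simp only [Complex.real_smul, hγ]
    ring

/-- The Bessel-potential representation of the high-frequency part of a network. -/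
theorem isBesselPotentialOf_sub_convHat {Φ : EuclideanSpace ℝ (Fin d) → ℝ} {φ : ℝ → ℝ}
    (h : HasRadialGenFourier Φ φ) {k : ℝ} (ξ : Fin N → EuclideanSpace ℝ (Fin d)) (a : Fin N → ℝ)
    (hg : Integrable (rbfNetwork Φ ξ a)) {K : EuclideanSpace ℝ (Fin d) → ℝ} (hK : Integrable K)
    (hK0 : fourierHat (fun x => (K x : ℂ)) 0 = 1) {H : EuclideanSpace ℝ (Fin d) → ℂ}
    (hH : Integrable H) (hHe : ∀ ω, H (-ω) = H ω)
    (hHK : ∀ ω, H ω * (((1 + ‖ω‖ ^ 2) ^ (-k / 2) : ℝ) : ℂ) =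
      φ ‖ω‖ * (1 - fourierHat (fun x => (K x : ℂ)) ω)) :
    IsBesselPotentialOf k
      (fun x => ((rbfNetwork Φ ξ a x - convHat (rbfNetwork Φ ξ a) K x : ℝ) : ℂ))
      (fun x => ∑ j, (a j : ℂ) * fourierHat H (x - ξ j)) := by
  intro ψ
  have hgrow : (fun ω : EuclideanSpace ℝ (Fin d) =>
      (((1 + ‖ω‖ ^ 2) ^ (-k / 2) : ℝ) : ℂ)).HasTemperateGrowth := by fun_prop
  -- The Bessel weight has temperate growth, so its product with `ψ` is again a Schwartz function.
  let θ : 𝓢(EuclideanSpace ℝ (Fin d), ℂ) := SchwartzMap.smulLeftCLM ℂ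
    (fun ω : EuclideanSpace ℝ (Fin d) => (((1 + ‖ω‖ ^ 2) ^ (-k / 2) : ℝ) : ℂ)) ψ
  have hθ : ∀ ω, θ ω = (((1 + ‖ω‖ ^ 2) ^ (-k / 2) : ℝ) : ℂ) * ψ ω := fun ω => by
    simp only [θ]
    rw [SchwartzMap.smulLeftCLM_apply_apply hgrow, smul_eq_mul]
  have hθ' : (fun ω => (((1 + ‖ω‖ ^ 2) ^ (-k / 2) : ℝ) : ℂ) * ψ ω) = fun ω => θ ω :=
    funext fun ω => (hθ ω).symm
  set g := rbfNetwork Φ ξ a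
  set gh := fourierHat (fun x => (g x : ℂ))
  set Kh := fourierHat (fun x => (K x : ℂ))
  have hci := integrable_convHat hg hK
  have hfi : Integrable (fun x => ((g x - convHat g K x : ℝ) : ℂ)) := by
    simp only [Complex.ofReal_sub]
    exact hg.ofReal.sub hci
  have hfh : ∀ ω, fourierHat (fun x => ((g x - convHat g K x : ℝ) : ℂ)) ω =
      gh ω * (1 - Kh ω) := fun ω => by
    have h1 : fourierHat (fun x => ((g x - convHat g K x : ℝ) : ℂ)) ω =
        gh ω - fourierHat (fun x => ((convHat g K x : ℝ) : ℂ)) ω := by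
      simp only [Complex.ofReal_sub]
      exact fourierHat_sub (hg.ofReal (𝕜 := ℂ)) hci ω
    rw [h1, fourierHat_convHat hg hK]
    ring
  have hmod : ∀ j x, fourierHat H (x - ξ j) =
      fourierHat (fun ω => Complex.exp (-((inner ℝ ω (-ξ j) : ℝ) : ℂ) * Complex.I) * H ω) x :=
    fun j x => by rw [fourierHat_modulate, sub_eq_add_neg]
  have hHj : ∀ j, Integrable (fun ω =>
      Complex.exp (-((inner ℝ ω (-ξ j) : ℝ) : ℂ) * Complex.I) * H ω) := fun j => by
    refine hH.bdd_mul (c := 1) (Continuous.aestronglyMeasurable (by fun_prop))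
      (Filter.Eventually.of_forall fun ω => ?_)
    rw [← Complex.ofReal_neg, Complex.norm_exp_ofReal_mul_I]
  have hHj' : ∀ j, Integrable (fun ω =>
      Complex.exp (-((inner ℝ ω (ξ j) : ℝ) : ℂ) * Complex.I) * (H ω * θ ω)) := fun j => by
    have h1 : Integrable (fun ω => H ω * θ ω) := by
      obtain ⟨c, hc⟩ := θ.decay 0 0
      exact hH.mul_bdd (c := c) θ.continuous.aestronglyMeasurable
        (Filter.Eventually.of_forall fun ω => by simpa using hc.2 ω)
    refine h1.bdd_mul (c := 1) (Continuous.aestronglyMeasurable (by fun_prop))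
      (Filter.Eventually.of_forall fun ω => ?_)
    rw [← Complex.ofReal_neg, Complex.norm_exp_ofReal_mul_I]
  have hθi : Integrable (fourierHat (fun ω => θ ω)) := integrable_fourierHat θ
  have hR : ∀ j, ∫ x, fourierHat H (x - ξ j) * fourierHat (fun ω => θ ω) x =
      ∫ ω, Complex.exp (-((inner ℝ ω (ξ j) : ℝ) : ℂ) * Complex.I) * (H ω * θ ω) := fun j => by
    simp only [hmod]
    rw [integral_fourierHat_mul (hHj j) hθi]
    -- The double transform reflects `θ`; substituting `-ω` and using that `H` is even undoes the
    -- reflection.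
    rw [← integral_neg_eq_self]
    refine integral_congr_ae (Filter.Eventually.of_forall fun ω => ?_)
    simp only
    rw [hHe, fourierHat_fourierHat, neg_neg, inner_neg_neg]
    ring
  have hRi : ∀ j, Integrable (fun x => fourierHat H (x - ξ j) * fourierHat (fun ω => θ ω) x) :=
    fun j => by
    refine hθi.bdd_mul (c := ‖(hatConst d : ℂ)‖ * ∫ ω, ‖H ω‖)
      ((continuous_fourierHat hH).comp (continuous_id.sub continuous_const)).aestronglyMeasurable
      (Filter.Eventually.of_forall fun x => ?_)
    rw [fourierHat_eq, norm_mul]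
    refine mul_le_mul_of_nonneg_left ?_ (norm_nonneg _)
    exact VectorFourier.norm_fourierIntegral_le_integral_norm _ _ _ _ _
  rw [hθ', ← integral_fourierHat_mul hfi ψ.integrable]
  simp only [Finset.sum_mul, mul_assoc]
  rw [integral_finsetSum _ fun j _ => (hRi j).const_mul _]
  simp only [integral_const_mul, hR]
  simp only [← integral_const_mul]
  rw [← integral_finsetSum _ fun j _ => (hHj' j).const_mul _]
  refine integral_congr_ae ?_
  filter_upwards [fourierHat_rbfNetwork_ae_eq h ξ a hg] with ω hω
  have h3 : ∑ j, (a j : ℂ) * (Complex.exp (-((inner ℝ ω (ξ j) : ℝ) : ℂ) * Complex.I) *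
      (H ω * θ ω)) = expSum ξ a ω * (φ ‖ω‖ * (1 - Kh ω)) * ψ ω := by
    rw [← hHK, hθ, expSum, mul_assoc, Finset.sum_mul]
    refine Finset.sum_congr rfl fun j _ => ?_
    ring
  rw [hfh, h3]
  -- The formula for the transform of `g` says nothing at the origin, where `1 - K̂` vanishes. This
  -- pointwise check also covers dimension `0`, where the origin is not a null set.
  by_cases h0 : ω = 0
  · rw [h0, hK0]
    ring
  · have h4 : gh ω = φ ‖ω‖ * expSum ξ a ω := hω h0
    rw [h4]
    ring

end Network

/-! ### Constants, exponents and the final estimate -/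

section MainTheorem

open FourierTransform

variable {d : ℕ}

theorem enorm_fourierHat (f : EuclideanSpace ℝ (Fin d) → ℂ) (x : EuclideanSpace ℝ (Fin d)) :
    ‖fourierHat f x‖ₑ = ENNReal.ofReal (hatConst d) * ‖𝓕 f ((2 * Real.pi)⁻¹ • x)‖ₑ := by
  rw [fourierHat_eq, enorm_mul, ← ofReal_norm, Complex.norm_real,
    Real.norm_of_nonneg (hatConst_pos d).le]

theorem lintegral_enorm_fourierHat {f : EuclideanSpace ℝ (Fin d) → ℂ} (hf : Integrable f) :
    ∫⁻ x, ‖fourierHat f x‖ₑ =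
      ENNReal.ofReal (hatConst d) * (ENNReal.ofReal ((2 * Real.pi) ^ d) * ∫⁻ x, ‖𝓕 f x‖ₑ) := by
  have hτ : (0 : ℝ) < 2 * Real.pi := by positivity
  have hm : Measurable fun x : EuclideanSpace ℝ (Fin d) => ‖𝓕 f ((2 * Real.pi)⁻¹ • x)‖ₑ :=
    ((continuous_fourier_of_integrable hf).comp (continuous_const_smul _)).enorm.measurable
  simp only [enorm_fourierHat]
  rw [lintegral_const_mul _ hm, ← lintegral_comp_smul_of_pos hm hτ]
  simp only [smul_smul, inv_mul_cancel₀ hτ.ne', one_smul, finrank_euclideanSpace_fin]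

theorem contDiff_fourierHat (K : 𝓢(EuclideanSpace ℝ (Fin d), ℝ)) (M : ℕ) :
    ContDiff ℝ M (fourierHat (fun x => (K x : ℂ))) := by
  have h : fourierHat (fun x => (K x : ℂ)) =
      fun ω => (hatConst d : ℂ) * 𝓕 (fun x => (K x : ℂ)) ((2 * Real.pi)⁻¹ • ω) :=
    funext (fourierHat_eq _)
  have h1 : ContDiff ℝ ((M : ℕ∞) : WithTop ℕ∞) (𝓕 (fun x => (K x : ℂ))) :=
    Real.contDiff_fourier fun n _ => by
      simpa using K.integrable_pow_mul volume n
  rw [h]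
  exact contDiff_const.mul (h1.comp (contDiff_const_smul _))

theorem integrable_dilate (K : 𝓢(EuclideanSpace ℝ (Fin d), ℝ)) {σ : ℝ} (hσ : 0 < σ) :
    Integrable (dilate σ K) :=
  (K.integrable.comp_smul hσ.ne').const_mul _

theorem exists_contDiffOn_of_isAdmissible {Φ : EuclideanSpace ℝ (Fin d) → ℝ} {β : ℝ}
    (hΦ : IsAdmissible Φ β) : ∃ (φ : ℝ → ℝ) (M : ℕ) (C : ℝ), HasRadialGenFourier Φ φ ∧
      d < 2 * M ∧ ContDiffOn ℝ M (fun r => (1 + r ^ 2) ^ (β / 2) * φ r) (Set.Ici (1 / 2)) ∧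
      ∀ s, 1 < s → ∀ n ≤ M, ∀ x : ℝ, 1 / 2 ≤ x →
        |iteratedDerivWithin n (fun x => (1 + (s * x) ^ 2) ^ (β / 2) * φ (s * x))
          (Set.Ici (1 / 2)) x| ≤ C := by
  obtain ⟨-, -, φ, hgen, C₁, C₂, -, -, h⟩ := hΦ
  have hm : (d : ℝ) + 3 ≤ 2 * ⌈((d : ℝ) + 3) / 2⌉₊ := by
    have := Nat.le_ceil (((d : ℝ) + 3) / 2)
    linarith
  have hm' : d + 3 ≤ 2 * ⌈((d : ℝ) + 3) / 2⌉₊ := by exact_mod_cast hm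
  -- One order is given up: the top derivative is bounded but not known to be continuous. Since
  -- `2⌈(d+3)/2⌉ ≥ d + 3`, what remains still exceeds `d/2`.
  refine ⟨φ, ⌈((d : ℝ) + 3) / 2⌉₊ - 1, C₂, hgen, by omega, ?_, ?_⟩
  · have h1 := (h 1 le_rfl).2.1
    simp only [one_mul] at h1
    refine contDiffOn_of_differentiableOn_deriv (n := ((⌈((d : ℝ) + 3) / 2⌉₊ - 1 : ℕ) : ℕ∞))
      fun l hl => h1 l ?_
    have : l ≤ ⌈((d : ℝ) + 3) / 2⌉₊ - 1 := by exact_mod_cast hl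
    omega
  · exact fun s hs n hn x hx => (h s hs.le).2.2 n (hn.trans (Nat.sub_le _ _)) x hx

/-- Exponent bookkeeping for the Young bound: `b x + (b + c) y = b + c y` when `x + y = 1`, with `b
= k - β`, `c = d` and `y = 1/p'` in the application. -/
theorem rpow_mul_rpow_le {D A S : ℝ≥0∞} {q b c x y : ℝ} (hq : 0 < q) (hx : 0 ≤ x) (hy : 0 ≤ y)
    (hxy : x + y = 1) (hA : A ≤ D * ENNReal.ofReal ((1 / q) ^ b))
    (hS : S ≤ D * ENNReal.ofReal ((1 / q) ^ (b + c))) :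
    A ^ x * S ^ y ≤ D * ENNReal.ofReal (q ^ (-b - c * y)) := by
  have hq' : 0 < 1 / q := by positivity
  calc A ^ x * S ^ y ≤ (D * ENNReal.ofReal ((1 / q) ^ b)) ^ x *
        (D * ENNReal.ofReal ((1 / q) ^ (b + c))) ^ y := by gcongr
    _ = (D ^ x * D ^ y) *
        ENNReal.ofReal (((1 / q) ^ b) ^ x * ((1 / q) ^ (b + c)) ^ y) := by
        rw [ENNReal.mul_rpow_of_nonneg _ _ hx, ENNReal.mul_rpow_of_nonneg _ _ hy,
          ENNReal.ofReal_rpow_of_pos (by positivity), ENNReal.ofReal_rpow_of_pos (by positivity),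
          ENNReal.ofReal_mul (by positivity)]
        ring
    _ = D * ENNReal.ofReal (q ^ (-b - c * y)) := by
        rw [← ENNReal.rpow_add_of_nonneg _ _ hx hy, hxy, ENNReal.rpow_one,
          ← Real.rpow_mul hq'.le, ← Real.rpow_mul hq'.le, ← Real.rpow_add hq', one_div,
          Real.inv_rpow hq.le, ← Real.rpow_neg hq.le]
        congr 3
        have : x = 1 - y := by linarith
        rw [this]
        ring

end MainTheorem

end

theorem mainTheorem4 {d : ℕ} (Φ : EuclideanSpace ℝ (Fin d) → ℝ) (β : ℝ) (hΦ : IsAdmissible Φ β)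
    (K : 𝓢(EuclideanSpace ℝ (Fin d), ℝ)) (hK : IsBandKernel K) (k : ℝ) (hk : k < β - d) :
    ∃ C : ℝ, 0 < C ∧
      ∀ X : Set (EuclideanSpace ℝ (Fin d)), X.Countable →
        0 < separationRadius X → separationRadius X < 1 →
      ∀ (N : ℕ) (ξ : Fin N → EuclideanSpace ℝ (Fin d)) (a : Fin N → ℝ),
        Function.Injective ξ → (∀ j, ξ j ∈ X) →
      ∀ g : EuclideanSpace ℝ (Fin d) → ℝ, g = rbfNetwork Φ ξ a → g ∈ rbfSpace Φ X →
      ∀ p p' : ℝ≥0∞, 1 ≤ p → p⁻¹ + p'⁻¹ = 1 →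
        MemBesselSpace k p
          (fun x => ((g x - convHat g (dilate (1 / separationRadius X) K) x : ℝ) : ℂ)) ∧
        besselNorm k p
          (fun x => ((g x - convHat g (dilate (1 / separationRadius X) K) x : ℝ) : ℂ)) ≤
          ENNReal.ofReal (C * separationRadius X ^ (β - k - d * (p'⁻¹).toReal) *
            ‖(WithLp.toLp p a : PiLp p (fun _ : Fin N => ℝ))‖) := by
  obtain ⟨φ, M, C₀, hgen, hM, hF, hFB⟩ := exists_contDiffOn_of_isAdmissible hΦ
  obtain ⟨κ, -, hκh, hκ1, hκ0⟩ := hK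
  set F : ℝ → ℝ := fun r => (1 + r ^ 2) ^ (β / 2) * φ r with hFdef
  set Kh : EuclideanSpace ℝ (Fin d) → ℂ := fourierHat (fun x => (K x : ℂ)) with hKh
  have hfr : Module.finrank ℝ (EuclideanSpace ℝ (Fin d)) = d := finrank_euclideanSpace_fin
  have hKh1 : ∀ ω, ‖ω‖ ≤ 1 / 2 → Kh ω = 1 := fun ω hω => by
    rw [hκh, hκ1 ‖ω‖₊ (by rw [← NNReal.coe_le_coe]; simpa using hω)]
    simp
  have hKh0 : ∀ ω, 1 ≤ ‖ω‖ → Kh ω = 0 := fun ω hω => by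
    rw [hκh, hκ0 ‖ω‖₊ (by rw [← NNReal.coe_le_coe]; simpa using hω)]
    simp
  -- `(k - β)/2` is the power left after removing `(1+r²)^(β/2)` from the symbol `φ` and inserting
  -- the Bessel weight. The points are `2q`-separated, and passing to `𝓕` divides them by `2π`; with
  -- `σ = 1/q` this gives `δ = 2/(2π)`.
  obtain ⟨B, hBt, hB⟩ := exists_fourier_radialSymbol_le (e := (k - β) / 2)
    (by rw [hfr]; exact hM) (by rw [hfr]; linarith) (contDiff_fourierHat K M) hKh1 hKh0 hF hFB
    (δ := 2 * (2 * Real.pi)⁻¹) (by positivity)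
  set D : ℝ≥0∞ := ENNReal.ofReal (hatConst d) * (ENNReal.ofReal ((2 * Real.pi) ^ d) * B) +
    ENNReal.ofReal (hatConst d) * B with hD
  have hDt : D ≠ ∞ := ENNReal.add_ne_top.2
    ⟨ENNReal.mul_ne_top ENNReal.ofReal_ne_top (ENNReal.mul_ne_top ENNReal.ofReal_ne_top hBt),
      ENNReal.mul_ne_top ENNReal.ofReal_ne_top hBt⟩
  -- The summand `1` only secures positivity, as `D` may vanish.
  refine ⟨D.toReal + 1, by positivity, ?_⟩
  intro X _ hq0 hq1 N ξ a hξ hξX g hg hgS p p' hp hpp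
  subst hg
  have hgi : Integrable (rbfNetwork Φ ξ a) := hgS.2
  set q := separationRadius X with hq
  have hσ : 1 < 1 / q := by rw [lt_div_iff₀ hq0]; linarith
  have hσ0 : 0 < 1 / q := by positivity
  obtain ⟨hHi, hH1, hH2⟩ := hB (1 / q) hσ
  set H := radialSymbol ((k - β) / 2) F
    (fun ω : EuclideanSpace ℝ (Fin d) => 1 - Kh ((1 / q)⁻¹ • ω)) with hHdef
  have hdil : ∀ ω, fourierHat (fun x => (dilate (1 / q) K x : ℂ)) ω = Kh ((1 / q)⁻¹ • ω) :=
    fourierHat_dilate hσ0 K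
  -- Evenness uses that `K̂` is radial.
  have hHe : ∀ ω, H (-ω) = H ω := fun ω => by
    simp only [hHdef, radialSymbol, norm_neg, smul_neg, hκh, nnnorm_neg]
  have hHK : ∀ ω, H ω * (((1 + ‖ω‖ ^ 2) ^ (-k / 2) : ℝ) : ℂ) =
      φ ‖ω‖ * (1 - fourierHat (fun x => (dilate (1 / q) K x : ℂ)) ω) := fun ω => by
    have h1 : (1 + ‖ω‖ ^ 2) ^ (β / 2) * (1 + ‖ω‖ ^ 2) ^ ((k - β) / 2) *
        (1 + ‖ω‖ ^ 2) ^ (-k / 2) = 1 := by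
      have hpos : 0 < 1 + ‖ω‖ ^ 2 := by positivity
      rw [← Real.rpow_add hpos, ← Real.rpow_add hpos]
      rw [show β / 2 + (k - β) / 2 + -k / 2 = 0 by ring, Real.rpow_zero]
    have h2 := congrArg (fun r : ℝ => (r : ℂ)) h1
    simp only [Complex.ofReal_mul, Complex.ofReal_one] at h2
    simp only [hHdef, radialSymbol, hFdef, hdil, Complex.real_smul, Complex.ofReal_mul]
    linear_combination (φ ‖ω‖ : ℂ) * (1 - Kh ((1 / q)⁻¹ • ω)) * h2
  set u : EuclideanSpace ℝ (Fin d) → ℂ := fun x => ∑ j, (a j : ℂ) * fourierHat H (x - ξ j)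
  have hbes := isBesselPotentialOf_sub_convHat hgen (k := k) ξ a hgi (integrable_dilate K hσ0)
    (by rw [hdil, smul_zero]; exact hKh1 0 (by simp)) hHi hHe hHK
  have hdist : ∀ i j, i ≠ j → 2 * (2 * Real.pi)⁻¹ / (1 / q) ≤
      dist ((2 * Real.pi)⁻¹ • ξ i) ((2 * Real.pi)⁻¹ • ξ j) := fun i j hij => by
    have h1 : X.infsep ≤ dist (ξ i) (ξ j) :=
      Set.infsep_le_dist_of_mem (hξX i) (hξX j) (hξ.ne hij)
    have h2 : X.infsep = 2 * q := by rw [hq, separationRadius]; ring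
    rw [dist_smul₀, Real.norm_of_nonneg (by positivity), div_div_eq_mul_div, div_one]
    have : 0 < (2 * Real.pi)⁻¹ := by positivity
    nlinarith
  have hA : ∫⁻ x, ‖fourierHat H x‖ₑ ≤ D * ENNReal.ofReal ((1 / q) ^ (k - β)) := by
    rw [lintegral_enorm_fourierHat hHi, hD, add_mul]
    refine le_trans ?_ le_self_add
    rw [mul_assoc, mul_assoc]
    have h1 : 2 * ((k - β) / 2) = k - β := by ring
    rw [h1] at hH1
    gcongr
  have hS : ∀ x, ∑ j, ‖fourierHat H (x - ξ j)‖ₑ ≤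
      D * ENNReal.ofReal ((1 / q) ^ (k - β + d)) := fun x => by
    simp only [enorm_fourierHat, smul_sub]
    rw [← Finset.mul_sum, hD, add_mul]
    refine le_trans ?_ le_add_self
    rw [mul_assoc]
    have h1 : 2 * ((k - β) / 2) = k - β := by ring
    rw [h1, hfr] at hH2
    gcongr
    exact hH2 N (fun j => (2 * Real.pi)⁻¹ • ξ j) hdist _
  have hxy : (p⁻¹).toReal + (p'⁻¹).toReal = 1 := by
    have h1 : p⁻¹ ≠ ∞ := fun h => by rw [h] at hpp; simp at hpp
    have h2 : p'⁻¹ ≠ ∞ := fun h => by rw [h] at hpp; simp at hpp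
    rw [← ENNReal.toReal_add h1 h2, hpp, ENNReal.toReal_one]
  have hHc := continuous_fourierHat hHi
  have hnorm : eLpNorm u p ≤ ENNReal.ofReal ((D.toReal + 1) *
      q ^ (β - k - d * (p'⁻¹).toReal) *
        ‖(WithLp.toLp p a : PiLp p (fun _ : Fin N => ℝ))‖) := by
    refine (eLpNorm_sum_mul_translate_le hHc a ξ hA hS hp hpp).trans ?_
    have h1 := rpow_mul_rpow_le (c := d) hq0 (ENNReal.toReal_nonneg (a := p⁻¹))
      (ENNReal.toReal_nonneg (a := p'⁻¹)) hxy le_rfl le_rfl (D := D) (b := k - β)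
    rw [neg_sub] at h1
    rw [ENNReal.ofReal_mul (by positivity), ENNReal.ofReal_mul (by positivity)]
    refine mul_le_mul_left (h1.trans (mul_le_mul_left ?_ _)) _
    rw [← ENNReal.ofReal_toReal hDt, ENNReal.toReal_ofReal ENNReal.toReal_nonneg]
    exact ENNReal.ofReal_le_ofReal (by linarith)
  have hmem : MemLp u p := by
    refine ⟨Continuous.aestronglyMeasurable ?_, hnorm.trans_lt ENNReal.ofReal_lt_top⟩
    exact continuous_finsetSum _ fun j _ =>
      continuous_const.mul (hHc.comp (continuous_id.sub continuous_const))
  have htemp : IsTemperedFun (fun x => ((rbfNetwork Φ ξ a x -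
      convHat (rbfNetwork Φ ξ a) (dilate (1 / q) K) x : ℝ) : ℂ)) := by
    refine isTemperedFun_of_integrable ?_
    simp only [Complex.ofReal_sub]
    exact hgi.ofReal.sub (integrable_convHat hgi (integrable_dilate K hσ0))
  -- The norm is an infimum over representatives, so the explicit `u` bounds it from above without
  -- any appeal to uniqueness.
  exact ⟨⟨htemp, u, hmem, hbes⟩, (iInf₂_le_of_le u hmem (iInf_le _ hbes)).trans hnorm⟩
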